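/- Call a non-empty closed convex set $S\subset\mathbb R^n$ computable if the set of rational points of $S$ is decidable and dense in $S$. Let $S\subset\mathbb R^n$ be a compact computable convex set, let $\epsilon>0$ be rational, and let $x_0,y_0\in S$ be computable points with $|x_0-y_0|>\epsilon$. In the game $\Gamma(S,\epsilon)$ a strategy of Evader is a Borel function $v:[0,\infty)\to\mathbb R^n$ with $|v(t)|\le 1$ such that $y_v(t)=y_0+\int_0^t v(s)\,ds\in S$ for all $t\ge 0$. A strategy of Pursuer is a Borel function $u(x,y,w)$ of Pursuer's position, Evader's position and Evader's velocity, with $|u|\le 1$; a trajectory consistent with $u$ against $v$ is a solution $x_{u,v}$ on $[0,\infty)$ of $$x_{u,v}(t)=x_0+\int_0^t u\bigl(x_{u,v}(s),y_v(s),v(s)\bigr)\,ds .$$ The strategy $u$ is winning if for every strategy $v$ of Evader there is exactly one such trajectory, it stays in $S$, and $|x_{u,v}(t)-y_v(t)|\le\epsilon$ for some $t\ge 0$. Then Pursuer has a winning strategy $u$ in $\Gamma(S,\epsilon)$ such that, for every continuous strategy $v$ of Evader, the trajectory $x_{u,v}$ is computable relative to $v$: there is an oracle machine which, given as oracles any representation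 of $v$ (approximations to within $2^{-k}$ of the values of $v$ at rational times, and moduli of uniform continuity of $v$ on the intervals $[0,N]$) and any sequence of rationals $q_j$ with $|t-q_j|\le 2^{-j}$ for all $j$, where $t\ge 0$, outputs for each $k$ a rational point at distance less than $2^{-k}$ from $x_{u,v}(t)$. -/

import Mathlib

namespace Pursuit

open Set MeasureTheory

/-! ### Oracle computations on natural numbers -/

/-- Programs for partial recursive functions with access to `k` oracles `ℕ → ℕ`: the programs of
`Nat.Partrec.Code`, with an instruction that queries the `i`-th oracle at the current input. -/
inductive OracleCode (k : ℕ) : Type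
  | zero : OracleCode k
  | succ : OracleCode k
  | left : OracleCode k
  | right : OracleCode k
  | oracle : Fin k → OracleCode k
  | pair : OracleCode k → OracleCode k → OracleCode k
  | comp : OracleCode k → OracleCode k → OracleCode k
  | prec : OracleCode k → OracleCode k → OracleCode k
  | rfind : OracleCode k → OracleCode k

/-- The partial function computed by a program when its oracles are `o 0, …, o (k - 1)`.
The clauses are those of `Nat.RecursiveIn`; the program itself does not depend on the oracles. -/
def OracleCode.eval {k : ℕ} (o : Fin k → ℕ → ℕ) : OracleCode k → ℕ →. ℕ
  | .zero => fun _ => Part.some 0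
  | .succ => fun a => Part.some (a + 1)
  | .left => fun a => Part.some a.unpair.1
  | .right => fun a => Part.some a.unpair.2
  | .oracle i => fun a => Part.some (o i a)
  | .pair f g => fun a => (f.eval o a).bind fun x => (g.eval o a).map fun y => Nat.pair x y
  | .comp f g => fun a => (g.eval o a).bind (f.eval o)
  | .prec f g => fun a =>
      Nat.rec (f.eval o a.unpair.1)
        (fun y ih => ih.bind fun i => g.eval o (Nat.pair a.unpair.1 (Nat.pair y i))) a.unpair.2
  | .rfind f => fun a => Nat.rfind fun m => (f.eval o (Nat.pair a m)).map fun r => decide (r = 0)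

/-! ### Computability on `ℝⁿ` -/

/-- The rational number `(p - q) / (r + 1)` with code `⟨p, ⟨q, r⟩⟩`; every rational number has a
code. -/
def ratOfCode (c : ℕ) : ℚ :=
  ((c.unpair.1 : ℚ) - (c.unpair.2.unpair.1 : ℚ)) / ((c.unpair.2.unpair.2 : ℚ) + 1)

/-- The rational point of `ℝⁿ` coded by a natural number, which is read as a finite list of codes
of rational numbers, the coordinates (missing ones have code `0`, further ones are ignored). -/
noncomputable def pointOfCode (n : ℕ) (c : ℕ) : EuclideanSpace ℝ (Fin n) :=
  WithLp.toLp 2 fun i => ((ratOfCode ((Denumerable.ofNat (List ℕ) c).getD (i : ℕ) 0) : ℚ) : ℝ)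

/-- `φ : ω → ℚ` represents the real number `t`. -/
def RepresentsReal (φ : ℕ → ℕ) (t : ℝ) : Prop :=
  ∀ k : ℕ, |t - (ratOfCode (φ k) : ℝ)| ≤ 1 / 2 ^ k

/-- `φ : ω → ℚⁿ` represents the point `x` of `ℝⁿ`. -/
def RepresentsPoint {n : ℕ} (φ : ℕ → ℕ) (x : EuclideanSpace ℝ (Fin n)) : Prop :=
  ∀ k : ℕ, dist x (pointOfCode n (φ k)) ≤ 1 / 2 ^ k

/-- A point of `ℝⁿ` is computable if it has a computable representation. -/
def ComputablePoint {n : ℕ} (x : EuclideanSpace ℝ (Fin n)) : Prop :=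
  ∃ φ : ℕ → ℕ, Computable φ ∧ RepresentsPoint φ x

/-- Computable convex sets: non-empty, closed, convex, with a decidable set of rational points
which is dense in the set. -/
structure IsComputableConvex {n : ℕ} (S : Set (EuclideanSpace ℝ (Fin n))) : Prop where
  nonempty : S.Nonempty
  isClosed : IsClosed S
  convex : Convex ℝ S
  decidable : ComputablePred fun c : ℕ => pointOfCode n c ∈ S
  dense : S ⊆ closure (S ∩ Set.range (pointOfCode n))

/-- The pair `(val, mod)` represents the continuous function `v : [0, ∞) → ℝⁿ`: `val` gives
approximations of `v` at the rational points of `[0, ∞)` to within `2⁻ᵏ`, and `mod` gives moduli of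
uniform continuity of `v` on the intervals `[0, N]`. -/
structure RepresentsFunction {n : ℕ} (val mod : ℕ → ℕ) (v : ℝ → EuclideanSpace ℝ (Fin n)) :
    Prop where
  val_spec : ∀ c k : ℕ, 0 ≤ ratOfCode c →
    dist (v (ratOfCode c : ℝ)) (pointOfCode n (val (Nat.pair c k))) ≤ 1 / 2 ^ k
  mod_spec : ∀ N k : ℕ, ∀ s ∈ Icc (0 : ℝ) N, ∀ t ∈ Icc (0 : ℝ) N,
    |s - t| ≤ 1 / 2 ^ mod (Nat.pair N k) → dist (v s) (v t) ≤ 1 / 2 ^ k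

/-- The function `x : [0, ∞) → ℝⁿ` is computable relative to the continuous function
`v : [0, ∞) → ℝⁿ`: some oracle machine, given any representation of `v` and any representation
of any time `t ≥ 0` as oracles, computes from `k` a rational point at distance less than `2⁻ᵏ`
from `x t`. -/
def ComputableRelativeTo {n : ℕ} (v x : ℝ → EuclideanSpace ℝ (Fin n)) : Prop :=
  ∃ M : OracleCode 3, ∀ val mod : ℕ → ℕ, RepresentsFunction val mod v →
    ∀ t : ℝ, 0 ≤ t → ∀ φ : ℕ → ℕ, RepresentsReal φ t →
      ∀ k : ℕ, ∃ c ∈ M.eval ![φ, val, mod] k, dist (x t) (pointOfCode n c) < 1 / 2 ^ k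

/-! ### The game. Functions of time are used on `[0, ∞)` only. -/

/-- The position at time `t` of Evader, who starts at `y₀` and has velocity `v`. -/
noncomputable def evaderPosition {n : ℕ} (y₀ : EuclideanSpace ℝ (Fin n))
    (v : ℝ → EuclideanSpace ℝ (Fin n)) (t : ℝ) : EuclideanSpace ℝ (Fin n) :=
  y₀ + ∫ s in (0 : ℝ)..t, v s

/-- Evader's strategies: Borel functions `v` on `[0, ∞)` with `|v| ≤ 1` that keep Evader in `S`. -/
def evaderStrategies {n : ℕ} (S : Set (EuclideanSpace ℝ (Fin n)))
    (y₀ : EuclideanSpace ℝ (Fin n)) : Set (ℝ → EuclideanSpace ℝ (Fin n)) :=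
  {v | Measurable ((Ici (0 : ℝ)).domRestrict v) ∧ (∀ t, 0 ≤ t → ‖v t‖ ≤ 1) ∧
    ∀ t, 0 ≤ t → evaderPosition y₀ v t ∈ S}

/-- Pursuer's strategies: Borel functions `u` with `|u| ≤ 1` of Pursuer's position, Evader's
position and Evader's velocity. -/
def pursuerStrategies (n : ℕ) :
    Set (EuclideanSpace ℝ (Fin n) × EuclideanSpace ℝ (Fin n) × EuclideanSpace ℝ (Fin n) →
      EuclideanSpace ℝ (Fin n)) :=
  {u | Measurable u ∧ ∀ p, ‖u p‖ ≤ 1}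

/-- `x` is a trajectory of Pursuer that is consistent with `u` against `v`:
`x t = x₀ + ∫₀ᵗ u (x s, y s, v s) ds` for all `t ≥ 0`. -/
def IsTrajectory {n : ℕ} (x₀ y₀ : EuclideanSpace ℝ (Fin n))
    (u : EuclideanSpace ℝ (Fin n) × EuclideanSpace ℝ (Fin n) × EuclideanSpace ℝ (Fin n) →
      EuclideanSpace ℝ (Fin n))
    (v x : ℝ → EuclideanSpace ℝ (Fin n)) : Prop :=
  ∀ t : ℝ, 0 ≤ t →
    IntervalIntegrable (fun s => u (x s, evaderPosition y₀ v s, v s)) volume 0 t ∧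
    x t = x₀ + ∫ s in (0 : ℝ)..t, u (x s, evaderPosition y₀ v s, v s)

/-- `u` is a winning strategy of Pursuer in the game with `ε`-catch in `S`: against every strategy
`v` of Evader it determines exactly one trajectory, which stays in `S` and at some time comes
within distance `ε` of Evader. -/
def IsWinningStrategy {n : ℕ} (S : Set (EuclideanSpace ℝ (Fin n))) (ε : ℝ)
    (x₀ y₀ : EuclideanSpace ℝ (Fin n))
    (u : EuclideanSpace ℝ (Fin n) × EuclideanSpace ℝ (Fin n) × EuclideanSpace ℝ (Fin n) →
      EuclideanSpace ℝ (Fin n)) : Prop :=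
  u ∈ pursuerStrategies n ∧ ∀ v ∈ evaderStrategies S y₀,
    ∃ x : ℝ → EuclideanSpace ℝ (Fin n), IsTrajectory x₀ y₀ u v x ∧
      (∀ x', IsTrajectory x₀ y₀ u v x' → EqOn x' x (Ici 0)) ∧
      (∀ t, 0 ≤ t → x t ∈ S) ∧
      ∃ t, 0 ≤ t ∧ dist (x t) (evaderPosition y₀ v t) ≤ ε

end Pursuit

/-!
Pursuer runs straight at Evader: with `z = y - x`, the velocity is `z / max |z| ε`
(`pursuitVelocity`). Slowing down within distance `ε`, when Evader is already caught, makes it a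
Lipschitz function of `z`, and this gives everything but the capture.

* The equation of motion has exactly one solution (`exists_pursuit`, `IsTrajectory.eqOn`). It stays
  in `S`, because Pursuer always heads for a point of the convex set `S` (`pursuit_mem`).
* The solution is the limit of polygons with an explicit rate (`dist_pursuitPolygon_le`). The
  vertices of the polygons are computed in exact rational arithmetic, with a rational approximation
  of the norm, by a program that is primitive recursive apart from the oracle queries and the given
  approximations of `x₀` and `y₀` (`exists_oracleComputable_pursuitPolygon`). A trajectory is
  `1`-Lipschitz, so the time may be replaced by one rational approximation.

Capture (`exists_dist_le_of_pursuit`) is the statement that simple pursuit succeeds in a bounded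
domain. Suppose that `|z| > ε` for ever, let `e = z / |z|` be the direction of pursuit and
`w = v - e = z'`. Since `|v| ≤ 1 = |e|`, the derivative `⟪e, w⟫` of `|z|` is at most `-|w|² / 2`.
As `|z| ≥ 0`, there are time intervals of any prescribed length `T` on which `∫ |w|²`
is as small as desired, so that `z`, and hence `e`, is almost constant. On such an interval Pursuer
runs at unit speed nearly along a straight line, a distance of at least `T / 2`, which is impossible
if `T` is larger than twice the diameter of the set.
-/

namespace Pursuit

open Set MeasureTheory

/-! ### Total oracle computations -/

/-- `f` is computed by one program that halts on every input, whatever the oracles are. -/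
def OracleComputable {k : ℕ} (f : (Fin k → ℕ → ℕ) → ℕ → ℕ) : Prop :=
  ∃ M : OracleCode k, ∀ o a, M.eval o a = Part.some (f o a)

/-- `OracleCode` has the instructions that generate `Nat.Partrec`, so programs without queries
compute all partial recursive functions. -/
theorem exists_oracleCode_of_partrec (k : ℕ) {f : ℕ →. ℕ} (hf : Nat.Partrec f) :
    ∃ M : OracleCode k, ∀ o, M.eval o = f := by
  induction hf with
  | zero => exact ⟨.zero, fun o => rfl⟩
  | succ => exact ⟨.succ, fun o => rfl⟩
  | left => exact ⟨.left, fun o => rfl⟩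
  | right => exact ⟨.right, fun o => rfl⟩
  | pair _ _ ihf ihg =>
    obtain ⟨F, hF⟩ := ihf
    obtain ⟨G, hG⟩ := ihg
    refine ⟨.pair F G, fun o => ?_⟩
    funext a
    simp [OracleCode.eval, hF, hG, Seq.seq, Part.bind_map]
  | comp _ _ ihf ihg =>
    obtain ⟨F, hF⟩ := ihf
    obtain ⟨G, hG⟩ := ihg
    refine ⟨.comp F G, fun o => ?_⟩
    funext a
    simp only [OracleCode.eval, hF, hG]
    rfl
  | prec _ _ ihf ihg =>
    obtain ⟨F, hF⟩ := ihf
    obtain ⟨G, hG⟩ := ihg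
    refine ⟨.prec F G, fun o => ?_⟩
    funext a
    simp [OracleCode.eval, hF, hG, Nat.unpaired]
  | rfind _ ihf =>
    obtain ⟨F, hF⟩ := ihf
    refine ⟨.rfind F, fun o => ?_⟩
    funext a
    simp [OracleCode.eval, hF]

namespace OracleComputable

variable {k : ℕ} {f g : (Fin k → ℕ → ℕ) → ℕ → ℕ}

theorem of_computable {f : ℕ → ℕ} (hf : Computable f) :
    OracleComputable fun _ : Fin k → ℕ → ℕ => f := by
  obtain ⟨M, hM⟩ := exists_oracleCode_of_partrec k (Partrec.nat_iff.1 hf)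
  exact ⟨M, fun o a => by rw [hM]; rfl⟩

theorem comp (hf : OracleComputable f) (hg : OracleComputable g) :
    OracleComputable fun o a => f o (g o a) := by
  obtain ⟨F, hF⟩ := hf
  obtain ⟨G, hG⟩ := hg
  exact ⟨.comp F G, fun o a => by
    simpa only [OracleCode.eval, hG] using (Part.bind_some _ _).trans (hF _ _)⟩

theorem pair (hf : OracleComputable f) (hg : OracleComputable g) :
    OracleComputable fun o a => Nat.pair (f o a) (g o a) := by
  obtain ⟨F, hF⟩ := hf
  obtain ⟨G, hG⟩ := hg
  exact ⟨.pair F G, fun o a => by simp [OracleCode.eval, hF, hG]⟩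

theorem oracle (i : Fin k) (hf : OracleComputable f) : OracleComputable fun o a => o i (f o a) :=
  comp ⟨.oracle i, fun _ _ => rfl⟩ hf

theorem of_primrec_comp {f : ℕ → ℕ} (hf : Primrec f) (hg : OracleComputable g) :
    OracleComputable fun o a => f (g o a) :=
  (of_computable hf.to_comp).comp hg

theorem id : OracleComputable fun (_ : Fin k → ℕ → ℕ) a => a := of_computable Computable.id

theorem prec (hf : OracleComputable f) (hg : OracleComputable g) :
    OracleComputable fun o a => Nat.rec (motive := fun _ => ℕ) (f o a.unpair.1)
      (fun y ih => g o (Nat.pair a.unpair.1 (Nat.pair y ih))) a.unpair.2 := by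
  obtain ⟨F, hF⟩ := hf
  obtain ⟨G, hG⟩ := hg
  refine ⟨.prec F G, fun o a => ?_⟩
  simp only [OracleCode.eval]
  induction a.unpair.2 with
  | zero => simp [hF]
  | succ m ih => simp only [ih]; simp [hG]

end OracleComputable

/-! ### Primitive recursive functions with rational values -/

/-- A function with rational values is primitive recursive if codes of its values are given by a
primitive recursive function. -/
def RatPrimrec {α : Type*} [Primcodable α] (f : α → ℚ) : Prop :=
  ∃ g : α → ℕ, Primrec g ∧ ∀ a, ratOfCode (g a) = f a

theorem ratOfCode_pair (p q r : ℕ) :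
    ratOfCode (Nat.pair p (Nat.pair q r)) = ((p : ℚ) - q) / (r + 1) := by
  simp [ratOfCode]

namespace RatPrimrec

variable {α β : Type*} [Primcodable α] [Primcodable β] {f g : α → ℚ}

theorem of_eq (hf : RatPrimrec f) (h : ∀ a, f a = g a) : RatPrimrec g :=
  (funext h : f = g) ▸ hf

theorem comp {f : β → ℚ} (hf : RatPrimrec f) {g : α → β} (hg : Primrec g) :
    RatPrimrec fun a => f (g a) := by
  obtain ⟨F, hF, h⟩ := hf
  exact ⟨fun a => F (g a), hF.comp hg, fun a => h _⟩

theorem of_triple {p q r : α → ℕ} (hp : Primrec p) (hq : Primrec q) (hr : Primrec r)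
    (h : ∀ a, f a = ((p a : ℚ) - q a) / (r a + 1)) : RatPrimrec f :=
  ⟨fun a => Nat.pair (p a) (Nat.pair (q a) (r a)),
    Primrec₂.natPair.comp hp (Primrec₂.natPair.comp hq hr), fun a => by rw [ratOfCode_pair, h]⟩

theorem exists_triple (hf : RatPrimrec f) : ∃ p q r : α → ℕ, Primrec p ∧ Primrec q ∧ Primrec r ∧
    ∀ a, f a = ((p a : ℚ) - q a) / (r a + 1) := by
  obtain ⟨F, hF, h⟩ := hf
  have h1 := Primrec.unpair.comp hF
  have h2 := Primrec.unpair.comp (Primrec.snd.comp h1)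
  exact ⟨_, _, _, Primrec.fst.comp h1, Primrec.fst.comp h2, Primrec.snd.comp h2,
    fun a => (h a).symm⟩

theorem ratOfCode : RatPrimrec Pursuit.ratOfCode := ⟨id, Primrec.id, fun _ => rfl⟩

theorem natCast {f : α → ℕ} (hf : Primrec f) : RatPrimrec fun a => (f a : ℚ) :=
  of_triple hf (Primrec.const 0) (Primrec.const 0) fun a => by simp

theorem const (q : ℚ) : RatPrimrec fun _ : α => q := by
  refine of_triple (Primrec.const q.num.toNat) (Primrec.const (-q.num).toNat)
    (Primrec.const (q.den - 1)) fun a => ?_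
  have h1 : ((q.num.toNat : ℤ) : ℚ) - ((-q.num).toNat : ℤ) = q.num := by
    rw [← Int.cast_sub]; congr 1; omega
  have h2 : ((q.den - 1 : ℕ) : ℚ) + 1 = q.den := by
    have := q.den_pos
    rw [← Nat.cast_succ]; congr 1; omega
  rw [h2, ← Int.cast_natCast q.num.toNat, ← Int.cast_natCast (-q.num).toNat, h1, Rat.num_div_den]

theorem add (hf : RatPrimrec f) (hg : RatPrimrec g) : RatPrimrec fun a => f a + g a := by
  obtain ⟨p, q, r, hp, hq, hr, h⟩ := hf.exists_triple
  obtain ⟨p', q', r', hp', hq', hr', h'⟩ := hg.exists_triple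
  refine of_triple
    (p := fun a => p a * (r' a + 1) + p' a * (r a + 1))
    (q := fun a => q a * (r' a + 1) + q' a * (r a + 1))
    (r := fun a => r a * r' a + r a + r' a) ?_ ?_ ?_ fun a => ?_
  · exact Primrec.nat_add.comp (Primrec.nat_mul.comp hp (Primrec.succ.comp hr'))
      (Primrec.nat_mul.comp hp' (Primrec.succ.comp hr))
  · exact Primrec.nat_add.comp (Primrec.nat_mul.comp hq (Primrec.succ.comp hr'))
      (Primrec.nat_mul.comp hq' (Primrec.succ.comp hr))
  · exact Primrec.nat_add.comp (Primrec.nat_add.comp (Primrec.nat_mul.comp hr hr') hr) hr'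
  · rw [h, h']; push_cast
    have h1 : (r a : ℚ) + 1 ≠ 0 := by positivity
    have h2 : (r' a : ℚ) + 1 ≠ 0 := by positivity
    have h3 : (r a : ℚ) * r' a + r a + r' a + 1 = (r a + 1) * (r' a + 1) := by ring
    rw [h3]
    field_simp
    ring

theorem mul (hf : RatPrimrec f) (hg : RatPrimrec g) : RatPrimrec fun a => f a * g a := by
  obtain ⟨p, q, r, hp, hq, hr, h⟩ := hf.exists_triple
  obtain ⟨p', q', r', hp', hq', hr', h'⟩ := hg.exists_triple
  refine of_triple
    (p := fun a => p a * p' a + q a * q' a)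
    (q := fun a => p a * q' a + q a * p' a)
    (r := fun a => r a * r' a + r a + r' a) ?_ ?_ ?_ fun a => ?_
  · exact Primrec.nat_add.comp (Primrec.nat_mul.comp hp hp') (Primrec.nat_mul.comp hq hq')
  · exact Primrec.nat_add.comp (Primrec.nat_mul.comp hp hq') (Primrec.nat_mul.comp hq hp')
  · exact Primrec.nat_add.comp (Primrec.nat_add.comp (Primrec.nat_mul.comp hr hr') hr) hr'
  · rw [h, h']; push_cast
    have h3 : (r a : ℚ) * r' a + r a + r' a + 1 = (r a + 1) * (r' a + 1) := by ring
    rw [h3, div_mul_div_comm]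
    ring

theorem sub (hf : RatPrimrec f) (hg : RatPrimrec g) : RatPrimrec fun a => f a - g a :=
  of_eq (hf.add ((const (-1)).mul hg)) fun a => by ring

theorem sum {ι : Type*} (s : Finset ι) {f : ι → α → ℚ} (hf : ∀ i, RatPrimrec (f i)) :
    RatPrimrec fun a => ∑ i ∈ s, f i a := by
  classical
  induction s using Finset.induction_on with
  | empty => simpa using const 0
  | insert i s hi ih => simpa [Finset.sum_insert hi] using (hf i).add ih

theorem primrec_ite_pos {p q : α → ℕ} (hp : Primrec p) (hq : Primrec q) :
    Primrec fun a => if q a < p a then 1 else 0 :=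
  Primrec.ite (Primrec.nat_lt.comp hq hp) (Primrec.const 1) (Primrec.const 0)

/-- The convention `0⁻¹ = 0` is respected: for `p = q` the code below is one of `0`. -/
theorem inv (hf : RatPrimrec f) : RatPrimrec fun a => (f a)⁻¹ := by
  obtain ⟨p, q, r, hp, hq, hr, h⟩ := hf.exists_triple
  refine of_triple
    (p := fun a => (r a + 1) * if q a < p a then 1 else 0)
    (q := fun a => (r a + 1) * if p a < q a then 1 else 0)
    (r := fun a => (p a - q a) + (q a - p a) - 1) ?_ ?_ ?_ fun a => ?_
  · exact Primrec.nat_mul.comp (Primrec.succ.comp hr) (primrec_ite_pos hp hq)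
  · exact Primrec.nat_mul.comp (Primrec.succ.comp hr) (primrec_ite_pos hq hp)
  · exact Primrec.nat_sub.comp
      (Primrec.nat_add.comp (Primrec.nat_sub.comp hp hq) (Primrec.nat_sub.comp hq hp))
      (Primrec.const 1)
  · rw [h, inv_div]
    rcases lt_trichotomy (p a) (q a) with hlt | heq | hgt
    · obtain ⟨d, hd⟩ := Nat.exists_eq_add_of_lt hlt
      have : p a - q a + (q a - p a) - 1 = d := by omega
      rw [this, if_neg hlt.not_gt, if_pos hlt, hd]
      push_cast
      have h1 : ((p a : ℚ) - (p a + d + 1) : ℚ) ≠ 0 := fun h0 => by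
        linarith [(Nat.cast_nonneg d : (0 : ℚ) ≤ d)]
      have h2 : (d : ℚ) + 1 ≠ 0 := by positivity
      rw [div_eq_div_iff h1 h2]
      ring
    · simp [heq]
    · obtain ⟨d, hd⟩ := Nat.exists_eq_add_of_lt hgt
      have : p a - q a + (q a - p a) - 1 = d := by omega
      rw [this, if_neg hgt.not_gt, if_pos hgt, hd]
      push_cast
      have h1 : ((q a + d + 1 : ℚ) - q a : ℚ) ≠ 0 := fun h0 => by
        linarith [(Nat.cast_nonneg d : (0 : ℚ) ≤ d)]
      have h2 : (d : ℚ) + 1 ≠ 0 := by positivity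
      rw [div_eq_div_iff h1 h2]
      ring

theorem max (hf : RatPrimrec f) (hg : RatPrimrec g) : RatPrimrec fun a => max (f a) (g a) := by
  obtain ⟨p, q, r, hp, hq, hr, h⟩ := hf.exists_triple
  obtain ⟨p', q', r', hp', hq', hr', h'⟩ := hg.exists_triple
  obtain ⟨F, hF, e⟩ := hf
  obtain ⟨G, hG, e'⟩ := hg
  refine ⟨fun a => if p a * (r' a + 1) + q' a * (r a + 1) ≤ p' a * (r a + 1) + q a * (r' a + 1)
    then G a else F a, ?_, fun a => ?_⟩
  · exact Primrec.ite (Primrec.nat_le.comp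
      (Primrec.nat_add.comp (Primrec.nat_mul.comp hp (Primrec.succ.comp hr'))
        (Primrec.nat_mul.comp hq' (Primrec.succ.comp hr)))
      (Primrec.nat_add.comp (Primrec.nat_mul.comp hp' (Primrec.succ.comp hr))
        (Primrec.nat_mul.comp hq (Primrec.succ.comp hr')))) hG hF
  · have key : f a ≤ g a ↔
        p a * (r' a + 1) + q' a * (r a + 1) ≤ p' a * (r a + 1) + q a * (r' a + 1) := by
      rw [h, h', div_le_div_iff₀ (by positivity) (by positivity), ← Nat.cast_le (α := ℚ)]
      push_cast
      constructor <;> intro H <;> linarith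
    dsimp only
    split_ifs with H
    · rw [e', max_eq_right (key.2 H)]
    · rw [e, max_eq_left (le_of_not_ge fun H' => H (key.1 H'))]

theorem natFloor (hf : RatPrimrec f) : Primrec fun a => ⌊f a⌋₊ := by
  obtain ⟨p, q, r, hp, hq, hr, h⟩ := hf.exists_triple
  refine (Primrec.nat_div.comp (Primrec.nat_sub.comp hp hq) (Primrec.succ.comp hr)).of_eq
    fun a => ?_
  rw [h]
  rcases le_total (p a) (q a) with hle | hle
  · rw [Nat.sub_eq_zero_of_le hle, Nat.zero_div, eq_comm, Nat.floor_eq_zero]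
    refine lt_of_le_of_lt (div_nonpos_of_nonpos_of_nonneg ?_ (by positivity)) one_pos
    rw [sub_nonpos]; exact_mod_cast hle
  · rw [← Nat.cast_sub hle, ← Nat.cast_succ, Nat.floor_div_eq_div]

end RatPrimrec

theorem primrec_pow {α : Type*} [Primcodable α] (b : ℕ) {f : α → ℕ} (hf : Primrec f) :
    Primrec fun a => b ^ f a := by
  have : Primrec fun m : ℕ => b ^ m := by
    refine (Primrec.nat_rec₁ (f := fun _ x => x * b) 1
      (Primrec.nat_mul.comp Primrec.snd (Primrec.const b))).of_eq fun m => ?_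
    induction m with
    | zero => rfl
    | succ m ih => simp only [pow_succ, ih]
  exact this.comp hf

/-- The `i`-th coordinate of the rational point with code `c`. -/
noncomputable def coord (c i : ℕ) : ℚ := ratOfCode ((Denumerable.ofNat (List ℕ) c).getD i 0)

theorem pointOfCode_apply {n : ℕ} (c : ℕ) (i : Fin n) : pointOfCode n c i = (coord c i : ℝ) := rfl

theorem ratPrimrec_coord (i : ℕ) : RatPrimrec fun c : ℕ => coord c i :=
  RatPrimrec.ratOfCode.comp
    ((Primrec.list_getD 0).comp (Primrec.ofNat (List ℕ)) (Primrec.const i))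

/-- A point with primitive recursive rational coordinates has a primitive recursive code. -/
theorem exists_primrec_coord_eq {α : Type*} [Primcodable α] {n : ℕ} {f : Fin n → α → ℚ}
    (hf : ∀ i, RatPrimrec (f i)) :
    ∃ g : α → ℕ, Primrec g ∧ ∀ a (i : Fin n), coord (g a) i = f i a := by
  choose F hF h using hf
  refine ⟨fun a => Encodable.encode (List.ofFn fun i => F i a),
    Primrec.encode.comp (Primrec.list_ofFn hF), fun a i => ?_⟩
  have : Denumerable.ofNat (List ℕ) (Encodable.encode (List.ofFn fun i => F i a)) =
      List.ofFn fun i => F i a := Denumerable.ofNat_encode _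
  rw [coord, this, ← h, List.getD_eq_getElem?_getD, List.getElem?_ofFn]
  simp

/-! ### Approximate pursuit with rational arithmetic -/

/-- A rational approximation, exact up to `2 * 2⁻ᵐ`, of `max (√q) ε`. -/
noncomputable def ratMaxSqrt (ε : ℚ) (m : ℕ) (q : ℚ) : ℚ :=
  max ε ((Nat.sqrt ⌊q * (4 ^ m : ℕ)⌋₊ : ℚ) * ((2 ^ m : ℕ) : ℚ)⁻¹)

theorem RatPrimrec.ratMaxSqrt {α : Type*} [Primcodable α] (ε : ℚ) {m : α → ℕ} (hm : Primrec m)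
    {f : α → ℚ} (hf : RatPrimrec f) : RatPrimrec fun a => ratMaxSqrt ε (m a) (f a) :=
  (RatPrimrec.const ε).max ((RatPrimrec.natCast
    (Primrec.nat_sqrt.comp (hf.mul (RatPrimrec.natCast (primrec_pow 4 hm))).natFloor)).mul
      (RatPrimrec.natCast (primrec_pow 2 hm)).inv)

theorem le_ratMaxSqrt (ε : ℚ) (m : ℕ) (q : ℚ) : ε ≤ ratMaxSqrt ε m q := le_max_left _ _

theorem abs_ratMaxSqrt_sub_le (ε : ℚ) (m : ℕ) {q : ℚ} {r : ℝ} (hr : 0 ≤ r) (hq : (q : ℝ) = r ^ 2) :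
    |(ratMaxSqrt ε m q : ℝ) - max r ε| ≤ 2 * (1 / 2 ^ m) := by
  have hq0 : (0 : ℚ) ≤ q := by
    have : (0 : ℝ) ≤ q := hq ▸ sq_nonneg r
    exact_mod_cast this
  set s := Nat.sqrt ⌊q * (4 ^ m : ℕ)⌋₊ with hs
  have h4 : (r * 2 ^ m) ^ 2 = ((q * (4 ^ m : ℕ) : ℚ) : ℝ) := by
    push_cast
    rw [hq, mul_pow, ← pow_mul, mul_comm m 2, pow_mul]
    norm_num
  have h2 : (0 : ℝ) < 2 ^ m := by positivity
  have hx : (0 : ℝ) ≤ r * 2 ^ m := by positivity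
  have hlow : (s : ℝ) ≤ r * 2 ^ m := by
    refine le_of_sq_le_sq ?_ hx
    rw [h4]
    have h : s ^ 2 ≤ ⌊q * (4 ^ m : ℕ)⌋₊ := Nat.sqrt_le' _
    have h' := (Nat.le_floor_iff (by positivity)).1 h
    exact_mod_cast h'
  have hup : r * 2 ^ m ≤ s + 1 := by
    refine le_of_sq_le_sq ?_ (by positivity)
    rw [h4]
    have h : ⌊q * (4 ^ m : ℕ)⌋₊ < (s + 1) ^ 2 := Nat.lt_succ_sqrt' _
    have h' := ((Nat.floor_lt (by positivity)).1 h).le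
    exact_mod_cast h'
  have hcast : (ratMaxSqrt ε m q : ℝ) = max (s / 2 ^ m : ℝ) ε := by
    rw [ratMaxSqrt, max_comm]
    push_cast [← hs]
    rw [div_eq_mul_inv, hs]
    push_cast
    rfl
  rw [hcast]
  refine (abs_max_sub_max_le_abs _ _ _).trans ?_
  have e : (s / 2 ^ m : ℝ) - r = (s - r * 2 ^ m) / 2 ^ m := by field_simp
  rw [e, abs_div, abs_of_pos h2, mul_one_div]
  gcongr
  rw [abs_le]
  constructor <;> linarith

/-- One step of the polygon method with step size `h` for the pair of Evader's and Pursuer's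
positions, on codes of rational points. -/
theorem exists_primrec_pursuit_step (n : ℕ) (ε : ℚ) {α : Type*} [Primcodable α] {m : α → ℕ}
    (hm : Primrec m) {h : α → ℚ} (hh : RatPrimrec h) {y x v : α → ℕ} (hy : Primrec y)
    (hx : Primrec x) (hv : Primrec v) :
    ∃ f : α → ℕ, Primrec f ∧ ∀ a, ∃ r : ℝ, (ε : ℝ) ≤ r ∧
      |r - max ‖pointOfCode n (y a) - pointOfCode n (x a)‖ ε| ≤ 2 * (1 / 2 ^ m a) ∧
      pointOfCode n (f a).unpair.1 = pointOfCode n (y a) + (h a : ℝ) • pointOfCode n (v a) ∧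
      pointOfCode n (f a).unpair.2 = pointOfCode n (x a) +
        (h a : ℝ) • r⁻¹ • (pointOfCode n (y a) - pointOfCode n (x a)) := by
  have hz : ∀ i : Fin n, RatPrimrec fun a => coord (y a) i - coord (x a) i := fun i =>
    ((ratPrimrec_coord i).comp hy).sub ((ratPrimrec_coord i).comp hx)
  have hr := RatPrimrec.ratMaxSqrt ε hm
    (RatPrimrec.sum Finset.univ fun i : Fin n => (hz i).mul (hz i))
  obtain ⟨Y, hY, hY'⟩ := exists_primrec_coord_eq fun i : Fin n =>
    ((ratPrimrec_coord i).comp hy).add (hh.mul ((ratPrimrec_coord i).comp hv))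
  obtain ⟨X, hX, hX'⟩ := exists_primrec_coord_eq fun i : Fin n =>
    ((ratPrimrec_coord i).comp hx).add (hh.mul (hr.inv.mul (hz i)))
  refine ⟨fun a => Nat.pair (Y a) (X a), Primrec₂.natPair.comp hY hX, fun a => ⟨_,
    Rat.cast_le.2 (le_ratMaxSqrt ε (m a) _), abs_ratMaxSqrt_sub_le ε (m a) (q := ∑ i : Fin n,
    (coord (y a) i - coord (x a) i) * (coord (y a) i - coord (x a) i)) (norm_nonneg _) ?_, ?_, ?_⟩⟩
  · rw [EuclideanSpace.norm_sq_eq]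
    push_cast
    refine Finset.sum_congr rfl fun i _ => ?_
    rw [Real.norm_eq_abs, sq_abs, PiLp.sub_apply, pointOfCode_apply, pointOfCode_apply]
    ring
  · ext i
    simp only [Nat.unpair_pair, pointOfCode_apply, hY', PiLp.add_apply, PiLp.smul_apply,
      smul_eq_mul]
    push_cast
    ring
  · ext i
    simp only [Nat.unpair_pair, pointOfCode_apply, hX', PiLp.add_apply, PiLp.smul_apply,
      PiLp.sub_apply, smul_eq_mul]
    push_cast
    ring

/-- `X` and `Y` are the vertices of polygons obtained by the polygon method with step size `h` for
the equations of motion of Pursuer and Evader, with velocities and norms known to within about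
`2⁻ᴷ`. -/
structure IsPursuitPolygon {n : ℕ} (ε : ℝ) (val : ℕ → ℕ) (K : ℕ) (h : ℚ)
    (X Y : ℕ → EuclideanSpace ℝ (Fin n)) : Prop where
  evader : ∀ j : ℕ, ∃ c, ratOfCode c = j * h ∧
    Y (j + 1) = Y j + (h : ℝ) • pointOfCode n (val (Nat.pair c K))
  pursuer : ∀ j : ℕ, ∃ r : ℝ, ε ≤ r ∧ |r - max ‖Y j - X j‖ ε| ≤ 2 * (1 / 2 ^ K) ∧
    X (j + 1) = X j + (h : ℝ) • r⁻¹ • (Y j - X j)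

/-- The program behind the computability of Pursuer's trajectory: from oracles for the time, for
Evader's velocity and for its moduli of continuity, and from `k`, it computes the last vertex of a
polygon with `J` edges that ends at the rational time `τ`. The bound `N ≥ τ` on the time determines
the precision `K`; the number `J` of edges makes the step size at most `2⁻ᴷ` and at most the modulus
of continuity at that precision. -/
theorem exists_oracleComputable_pursuitPolygon (n : ℕ) (ε : ℚ) (l : ℕ) {px py : ℕ → ℕ}
    (hpx : Computable px) (hpy : Computable py) :
    ∃ f : (Fin 3 → ℕ → ℕ) → ℕ → ℕ, OracleComputable f ∧ ∀ (φ val mod : ℕ → ℕ) (k : ℕ),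
      let τ : ℚ := max (ratOfCode (φ (k + 2))) 0
      let N : ℕ := ⌊τ⌋₊ + 1
      let K : ℕ := k + 4 + N + l * N
      let J : ℕ := N * 2 ^ (mod (Nat.pair N K) + K)
      ∃ X Y : ℕ → EuclideanSpace ℝ (Fin n), IsPursuitPolygon ε val K (τ * (J : ℚ)⁻¹) X Y ∧
        X 0 = pointOfCode n (px K) ∧ Y 0 = pointOfCode n (py K) ∧
        pointOfCode n (f ![φ, val, mod] k) = X J := by
  -- The parameters are functions of a context `w = ⟨k, ⟨q, m⟩⟩`, where `q` is a code of the time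
  -- and `m` the modulus.
  let τ : ℕ → ℚ := fun q => max (ratOfCode q) 0
  let N : ℕ → ℕ := fun q => ⌊τ q⌋₊ + 1
  let K : ℕ → ℕ → ℕ := fun k q => k + 4 + N q + l * N q
  let J : ℕ → ℕ → ℕ → ℕ := fun k q m => N q * 2 ^ (m + K k q)
  have hτ : RatPrimrec τ := RatPrimrec.ratOfCode.max (RatPrimrec.const 0)
  have hN : Primrec N := Primrec.succ.comp hτ.natFloor
  have hK : Primrec₂ K := Primrec.nat_add.comp (Primrec.nat_add.comp (Primrec.nat_add.comp
    Primrec.fst (Primrec.const 4)) (hN.comp Primrec.snd))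
      (Primrec.nat_mul.comp (Primrec.const l) (hN.comp Primrec.snd))
  have hc1 : Primrec fun w : ℕ => w.unpair.1 := Primrec.fst.comp Primrec.unpair
  have hc2 : Primrec fun w : ℕ => w.unpair.2 := Primrec.snd.comp Primrec.unpair
  have hq : Primrec fun w : ℕ => w.unpair.2.unpair.1 := hc1.comp hc2
  have hmod : Primrec fun w : ℕ => w.unpair.2.unpair.2 := hc2.comp hc2
  have hKw : Primrec fun w : ℕ => K w.unpair.1 w.unpair.2.unpair.1 := hK.comp hc1 hq
  have hJw : Primrec fun w : ℕ => J w.unpair.1 w.unpair.2.unpair.1 w.unpair.2.unpair.2 :=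
    Primrec.nat_mul.comp (hN.comp hq) (primrec_pow 2 (Primrec.nat_add.comp hmod hKw))
  have hh : RatPrimrec fun w : ℕ => τ w.unpair.2.unpair.1 *
      (J w.unpair.1 w.unpair.2.unpair.1 w.unpair.2.unpair.2 : ℚ)⁻¹ :=
    (hτ.comp hq).mul (RatPrimrec.natCast hJw).inv
  -- the code of the `j`-th time, as a function of `⟨w, j⟩`
  obtain ⟨T, hT, hT'⟩ := (RatPrimrec.natCast hc2).mul (hh.comp hc1)
  -- the step, as a function of `⟨⟨w, ⟨j, s⟩⟩, v⟩`
  obtain ⟨step, hstep, hstep'⟩ := exists_primrec_pursuit_step n ε (α := ℕ)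
    (m := fun a => K a.unpair.1.unpair.1.unpair.1 a.unpair.1.unpair.1.unpair.2.unpair.1)
    (hKw.comp (hc1.comp hc1)) (hh.comp (hc1.comp hc1))
    (y := fun a => a.unpair.1.unpair.2.unpair.2.unpair.1)
    (x := fun a => a.unpair.1.unpair.2.unpair.2.unpair.2)
    (v := fun a => a.unpair.2)
    (hc1.comp (hc2.comp (hc2.comp hc1))) (hc2.comp (hc2.comp (hc2.comp hc1))) hc2
  let query : ℕ → ℕ := fun b => Nat.pair (T (Nat.pair b.unpair.1 b.unpair.2.unpair.1))
    (K b.unpair.1.unpair.1 b.unpair.1.unpair.2.unpair.1)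
  have hquery : Primrec query := Primrec₂.natPair.comp
    (hT.comp (Primrec₂.natPair.comp hc1 (hc1.comp hc2))) (hKw.comp hc1)
  let G : (Fin 3 → ℕ → ℕ) → ℕ → ℕ := fun o b => step (Nat.pair b (o 1 (query b)))
  have hG : OracleComputable G :=
    .of_primrec_comp hstep (.pair .id (.oracle 1 (.of_primrec_comp hquery .id)))
  let I : (Fin 3 → ℕ → ℕ) → ℕ → ℕ := fun _ w => Nat.pair (py (K w.unpair.1 w.unpair.2.unpair.1))
    (px (K w.unpair.1 w.unpair.2.unpair.1))
  have hI : OracleComputable I :=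
    .pair (.of_computable (hpy.comp hKw.to_comp)) (.of_computable (hpx.comp hKw.to_comp))
  let P : (Fin 3 → ℕ → ℕ) → ℕ → ℕ → ℕ := fun o w j =>
    Nat.rec (I o w) (fun i ih => G o (Nat.pair w (Nat.pair i ih))) j
  let Q : (Fin 3 → ℕ → ℕ) → ℕ → ℕ := fun o k => o 0 (k + 2)
  have hQ : OracleComputable Q :=
    .oracle 0 (.of_computable (Primrec.nat_add.comp Primrec.id (Primrec.const 2)).to_comp)
  let W : (Fin 3 → ℕ → ℕ) → ℕ → ℕ := fun o k => Nat.pair k (Nat.pair (Q o k)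
    (o 2 (Nat.pair (N (Q o k)) (K k (Q o k)))))
  have hW : OracleComputable W := by
    refine .pair .id (.pair hQ (.oracle 2 (.pair (.of_primrec_comp hN hQ) ?_)))
    have hK' : Primrec fun w : ℕ => K w.unpair.1 w.unpair.2 := hK.comp hc1 hc2
    have := OracleComputable.of_primrec_comp hK' (.pair .id hQ)
    simpa only [Nat.unpair_pair] using this
  refine ⟨fun o k => (P o (W o k) (J (W o k).unpair.1 (W o k).unpair.2.unpair.1
    (W o k).unpair.2.unpair.2)).unpair.2, ?_, ?_⟩
  · have := OracleComputable.of_primrec_comp hc2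
      ((hI.prec hG).comp (.pair hW (.of_primrec_comp hJw hW)))
    simpa only [Nat.unpair_pair] using this
  · intro φ val mod k
    let q := φ (k + 2)
    let m := mod (Nat.pair (N q) (K k q))
    let w := Nat.pair k (Nat.pair q m)
    obtain ⟨s, hs⟩ : ∃ s : ℕ → ℕ, s = P ![φ, val, mod] w := ⟨_, rfl⟩
    have hs0 : s 0 = Nat.pair (py (K k q)) (px (K k q)) := by
      rw [hs]
      simp only [P, I, w, Nat.unpair_pair]
      rfl
    have hs1 : ∀ j, s (j + 1) = step (Nat.pair (Nat.pair w (Nat.pair j (s j)))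
        (val (Nat.pair (T (Nat.pair w j)) (K k q)))) := fun j => by
      have : s (j + 1) = step (Nat.pair (Nat.pair w (Nat.pair j (s j)))
          (val (query (Nat.pair w (Nat.pair j (s j)))))) := by rw [hs]; rfl
      rw [this]
      simp only [query, w, Nat.unpair_pair]
    have hout : P ![φ, val, mod] (W ![φ, val, mod] k) (J (W ![φ, val, mod] k).unpair.1
        (W ![φ, val, mod] k).unpair.2.unpair.1 (W ![φ, val, mod] k).unpair.2.unpair.2) =
        s (J k q m) := by
      have : W ![φ, val, mod] k = w := rfl
      rw [this, hs]
      simp only [w, Nat.unpair_pair]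
    have hTw : ∀ j, ratOfCode (T (Nat.pair w j)) = j * (τ q * (J k q m : ℚ)⁻¹) := fun j => by
      rw [hT']
      simp only [w, Nat.unpair_pair]
    have hst := fun j => hstep' (Nat.pair (Nat.pair w (Nat.pair j (s j)))
      (val (Nat.pair (T (Nat.pair w j)) (K k q))))
    simp only [← hs1] at hst
    simp only [w, Nat.unpair_pair] at hst
    change ∃ X Y : ℕ → EuclideanSpace ℝ (Fin n),
      IsPursuitPolygon ε val (K k q) (τ q * (J k q m : ℚ)⁻¹) X Y ∧
        X 0 = pointOfCode n (px (K k q)) ∧ Y 0 = pointOfCode n (py (K k q)) ∧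
        pointOfCode n (P ![φ, val, mod] (W ![φ, val, mod] k) (J (W ![φ, val, mod] k).unpair.1
          (W ![φ, val, mod] k).unpair.2.unpair.1
          (W ![φ, val, mod] k).unpair.2.unpair.2)).unpair.2 = X (J k q m)
    rw [hout]
    clear hout
    generalize hK0 : K k q = K₀ at *
    generalize J k q m = J₀ at *
    generalize τ q * (J₀ : ℚ)⁻¹ = h₀ at *
    refine ⟨fun j => pointOfCode n (s j).unpair.2, fun j => pointOfCode n (s j).unpair.1,
      ⟨fun j => ?_, fun j => ?_⟩, ?_, ?_, rfl⟩
    · obtain ⟨r, -, -, h, -⟩ := hst j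
      exact ⟨_, hTw j, h⟩
    · obtain ⟨r, hr, hr', -, h⟩ := hst j
      exact ⟨r, hr, hr', h⟩
    · simp only [hs0, Nat.unpair_pair]
    · simp only [hs0, Nat.unpair_pair]

section

variable {E : Type*} [NormedAddCommGroup E] [NormedSpace ℝ E]

/-! ### Capped direct pursuit -/

/-- The velocity of Pursuer when Evader is at displacement `z`: the unit vector towards Evader,
slowed down to `z / ε` within distance `ε` so that the velocity is a Lipschitz function of `z`. -/
noncomputable def pursuitVelocity (ε : ℝ) (z : E) : E := (max ‖z‖ ε)⁻¹ • z

variable {ε : ℝ}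

theorem norm_pursuitVelocity_le_one (hε : 0 < ε) (z : E) : ‖pursuitVelocity ε z‖ ≤ 1 := by
  have h : 0 < max ‖z‖ ε := lt_max_of_lt_right hε
  rw [pursuitVelocity, norm_smul, norm_inv, Real.norm_of_nonneg h.le, inv_mul_le_iff₀ h, mul_one]
  exact le_max_left _ _

/-- Stability of the velocity under errors in the displacement and in the capped norm; for the exact
capped norm `r = max ‖z‖ ε` it is the Lipschitz condition. -/
theorem norm_inv_smul_sub_pursuitVelocity_le (hε : 0 < ε) {r : ℝ} (hr : ε ≤ r) (z w : E) :
    ‖r⁻¹ • z - pursuitVelocity ε w‖ ≤ (‖z - w‖ + |r - max ‖w‖ ε|) / ε := by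
  have hr0 : 0 < r := hε.trans_le hr
  set R := max ‖w‖ ε with hR
  have hR0 : 0 < R := lt_max_of_lt_right hε
  have e : r⁻¹ • z - pursuitVelocity ε w = r⁻¹ • (z - w) + (r⁻¹ * (R - r)) • R⁻¹ • w := by
    rw [pursuitVelocity, ← hR, smul_sub, smul_smul, sub_add, ← sub_smul]
    congr 2
    field_simp
    ring
  have h1 : ‖R⁻¹ • w‖ ≤ 1 := norm_pursuitVelocity_le_one hε w
  have h2 : r⁻¹ ≤ ε⁻¹ := inv_anti₀ hε hr
  rw [e, div_eq_inv_mul, mul_add]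
  refine (norm_add_le _ _).trans (add_le_add ?_ ?_)
  · rw [norm_smul, norm_inv, Real.norm_of_nonneg hr0.le]
    gcongr
  · rw [norm_smul, norm_mul, norm_inv, Real.norm_of_nonneg hr0.le, Real.norm_eq_abs, abs_sub_comm]
    calc r⁻¹ * |r - R| * ‖R⁻¹ • w‖ ≤ r⁻¹ * |r - R| * 1 := by gcongr
      _ ≤ ε⁻¹ * |r - R| := by rw [mul_one]; gcongr

theorem norm_pursuitVelocity_sub_le (hε : 0 < ε) (z w : E) :
    ‖pursuitVelocity ε z - pursuitVelocity ε w‖ ≤ 2 / ε * ‖z - w‖ := by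
  refine (norm_inv_smul_sub_pursuitVelocity_le hε (le_max_right ‖z‖ ε) z w).trans ?_
  rw [div_mul_eq_mul_div]
  gcongr
  have := (abs_max_sub_max_le_abs ‖z‖ ‖w‖ ε).trans (abs_norm_sub_norm_le z w)
  linarith

theorem lipschitzWith_pursuitVelocity (hε : 0 < ε) :
    LipschitzWith (2 / ε).toNNReal (pursuitVelocity ε : E → E) :=
  LipschitzWith.of_dist_le_mul fun z w => by
    rw [dist_eq_norm, dist_eq_norm, Real.coe_toNNReal _ (by positivity)]
    exact norm_pursuitVelocity_sub_le hε z w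

theorem lipschitzWith_pursuitVelocity_sub (hε : 0 < ε) (y : E) :
    LipschitzWith (2 / ε).toNNReal fun x => pursuitVelocity ε (y - x) :=
  LipschitzWith.of_dist_le_mul fun z w => by
    have := (lipschitzWith_pursuitVelocity hε).dist_le_mul (y - z) (y - w)
    rwa [dist_sub_left] at this

theorem continuous_pursuitVelocity (hε : 0 < ε) : Continuous (pursuitVelocity ε : E → E) :=
  (lipschitzWith_pursuitVelocity hε).continuous

theorem exists_pursuit_Icc [CompleteSpace E] (hε : 0 < ε) {y : ℝ → E} (hy : Continuous y) (x₀ : E)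
    (m : ℕ) : ∃ x : ℝ → E, x 0 = x₀ ∧ ∀ t ∈ Ioo (-(m + 1) : ℝ) (m + 1),
      HasDerivAt x (pursuitVelocity ε (y t - x t)) t := by
  have h0 : (0 : ℝ) ∈ Icc (-(m + 1) : ℝ) (m + 1) := ⟨by linarith [m.cast_nonneg (α := ℝ)],
    by positivity⟩
  have hPL : IsPicardLindelof (fun t x => pursuitVelocity ε (y t - x))
      (⟨0, h0⟩ : Icc (-(m + 1) : ℝ) (m + 1)) x₀ (m + 1) 0 1 (2 / ε).toNNReal := by
    refine ⟨fun t _ => (lipschitzWith_pursuitVelocity_sub hε (y t)).lipschitzOnWith, fun x _ =>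
      ((continuous_pursuitVelocity hε).comp (hy.sub continuous_const)).continuousOn,
      fun t _ x _ => norm_pursuitVelocity_le_one hε _, ?_⟩
    simp
  obtain ⟨x, hx0, hx⟩ := hPL.exists_eq_forall_mem_Icc_hasDerivWithinAt₀
  exact ⟨x, hx0, fun t ht => (hx t (Ioo_subset_Icc_self ht)).hasDerivAt (Icc_mem_nhds ht.1 ht.2)⟩

/-- Global existence: the velocity is bounded, so the Picard–Lindelöf theorem gives solutions on
arbitrarily long intervals, and uniqueness glues them together. -/
theorem exists_pursuit [CompleteSpace E] (hε : 0 < ε) {y : ℝ → E} (hy : Continuous y) (x₀ : E) :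
    ∃ x : ℝ → E, x 0 = x₀ ∧ ∀ t, HasDerivAt x (pursuitVelocity ε (y t - x t)) t := by
  choose X hX0 hX using exists_pursuit_Icc hε hy x₀
  have hmem : ∀ m : ℕ, (0 : ℝ) ∈ Ioo (-(m + 1) : ℝ) (m + 1) := fun m =>
    ⟨by linarith [m.cast_nonneg (α := ℝ)], by positivity⟩
  have hmono : ∀ m k : ℕ, m ≤ k → EqOn (X m) (X k) (Ioo (-(m + 1) : ℝ) (m + 1)) := by
    intro m k hmk
    have hmk' : (m : ℝ) ≤ k := by exact_mod_cast hmk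
    refine ODE_solution_unique_of_mem_Ioo (s := fun _ => univ)
      (fun t _ => (lipschitzWith_pursuitVelocity_sub hε (y t)).lipschitzOnWith) (hmem m)
      (fun t ht => ⟨hX m t ht, trivial⟩) (fun t ht => ⟨hX k t ?_, trivial⟩) ?_
    · exact ⟨by linarith [ht.1], by linarith [ht.2]⟩
    · rw [hX0, hX0]
  refine ⟨fun t => X ⌈|t|⌉₊ t, hX0 _, fun t => ?_⟩
  have hin : ∀ s : ℝ, ∀ m : ℕ, |s| ≤ m → s ∈ Ioo (-(m + 1) : ℝ) (m + 1) := fun s m hs => by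
    rw [abs_le] at hs
    exact ⟨by linarith, by linarith⟩
  set m := ⌈|t|⌉₊ + 1 with hm
  have ht : t ∈ Ioo (-m : ℝ) m := by
    have := abs_le.1 (Nat.le_ceil |t|)
    rw [hm]; push_cast
    exact ⟨by linarith, by linarith⟩
  have hev : (fun s => X ⌈|s|⌉₊ s) =ᶠ[nhds t] X m := by
    filter_upwards [Ioo_mem_nhds ht.1 ht.2] with s hs
    exact hmono _ m (Nat.ceil_le.2 (abs_le.2 ⟨hs.1.le, hs.2.le⟩)) (hin s _ (Nat.le_ceil _))
  have hval : X ⌈|t|⌉₊ t = X m t := hev.self_of_nhds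
  change HasDerivAt _ (pursuitVelocity ε (y t - X ⌈|t|⌉₊ t)) t
  rw [hval]
  exact (hX m t ⟨by linarith [ht.1], by linarith [ht.2]⟩).congr_of_eventuallyEq hev

/-- Pursuer stays in every closed convex set that contains Evader. If an affine functional `f - u` is
negative on the set, its value at `x` times the integrating factor `exp (∫ 1 / max ‖y - x‖ ε)` is
nonincreasing and starts below `0`. -/
theorem pursuit_mem (hε : 0 < ε) {S : Set E} (hS : Convex ℝ S) (hS' : IsClosed S) {x y : ℝ → E}
    (hy : Continuous y) (hyS : ∀ t, 0 ≤ t → y t ∈ S) (hx0 : x 0 ∈ S)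
    (hx : ∀ t, HasDerivAt x (pursuitVelocity ε (y t - x t)) t) {t : ℝ} (ht : 0 ≤ t) : x t ∈ S := by
  by_contra hxt
  obtain ⟨f, u, hfu, hfx⟩ := geometric_hahn_banach_closed_point hS hS' hxt
  have hxc : Continuous x := continuous_iff_continuousAt.2 fun t => (hx t).continuousAt
  set a : ℝ → ℝ := fun s => (max ‖y s - x s‖ ε)⁻¹ with ha
  have hpos : ∀ s, 0 < max ‖y s - x s‖ ε := fun s => lt_max_of_lt_right hε
  have hac : Continuous a :=
    ((hy.sub hxc).norm.max continuous_const).inv₀ fun s => (hpos s).ne'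
  set A : ℝ → ℝ := fun s => ∫ r in (0 : ℝ)..s, a r with hA
  have hAd : ∀ s, HasDerivAt A (a s) s := fun s => hac.integral_hasStrictDerivAt 0 s |>.hasDerivAt
  set g : ℝ → ℝ := fun s => (f (x s) - u) * Real.exp (A s) with hg
  have hgd : ∀ s, HasDerivAt g (a s * (f (y s) - u) * Real.exp (A s)) s := fun s => by
    have h1 : HasDerivAt (fun s => f (x s) - u) (f (pursuitVelocity ε (y s - x s))) s :=
      (f.hasFDerivAt.comp_hasDerivAt s (hx s)).sub_const u
    refine (h1.mul (hAd s).exp).congr_deriv ?_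
    rw [pursuitVelocity, map_smul, map_sub, smul_eq_mul]
    simp only [ha]
    ring
  have hanti : AntitoneOn g (Icc 0 t) := by
    refine antitoneOn_of_deriv_nonpos (convex_Icc 0 t)
      (fun s _ => (hgd s).continuousAt.continuousWithinAt)
      (fun s _ => (hgd s).differentiableAt.differentiableWithinAt) fun s hs => ?_
    rw [interior_Icc] at hs
    rw [(hgd s).deriv]
    refine mul_nonpos_of_nonpos_of_nonneg (mul_nonpos_of_nonneg_of_nonpos
      (inv_nonneg.2 (hpos s).le) ?_) (Real.exp_pos _).le
    linarith [hfu _ (hyS s hs.1.le)]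
  have h := hanti (left_mem_Icc.2 ht) (right_mem_Icc.2 ht) ht
  have h0 : g 0 < 0 := mul_neg_of_neg_of_pos (by linarith [hfu _ hx0]) (Real.exp_pos _)
  have h1 : 0 < g t := mul_pos (by linarith) (Real.exp_pos _)
  linarith

end

/-! ### Capture -/

/-- A function whose increments are at most quadratic in the length of the interval is nonincreasing:
subdivide the interval. -/
theorem antitoneOn_of_sub_le_sq {D : ℝ → ℝ} {C : ℝ}
    (h : ∀ s t, 0 ≤ s → s ≤ t → D t - D s ≤ C * (t - s) ^ 2) : AntitoneOn D (Ici 0) := by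
  intro s hs t _ hst
  by_contra! hlt
  have hs : 0 ≤ s := hs
  obtain ⟨m, hm⟩ := exists_nat_gt (C * (t - s) ^ 2 / (D t - D s))
  have hm1 : (0 : ℝ) < m + 1 := by positivity
  set d := (t - s) / (m + 1) with hd
  have hd0 : 0 ≤ d := div_nonneg (by linarith) hm1.le
  have hsum : ∀ i : ℕ, D (s + i * d) - D s ≤ i * (C * d ^ 2) := by
    intro i
    induction i with
    | zero => simp
    | succ i ih =>
      have h1 := h (s + i * d) (s + (i + 1 : ℕ) * d) (by positivity) (by push_cast; nlinarith)
      push_cast at h1 ⊢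
      have e : s + (i + 1 : ℝ) * d - (s + i * d) = d := by ring
      rw [e] at h1
      linarith
  have h1 := hsum (m + 1)
  push_cast at h1
  have e1 : s + (m + 1 : ℝ) * d = t := by rw [hd]; field_simp; ring
  have e2 : (m + 1 : ℝ) * (C * d ^ 2) = C * (t - s) ^ 2 / (m + 1) := by rw [hd]; field_simp
  rw [e1, e2, le_div_iff₀ hm1] at h1
  rw [div_lt_iff₀ (by linarith)] at hm
  nlinarith

/-- A nonnegative function decreases little on some interval of length `T`: otherwise the decreases
on successive intervals would add up. -/
theorem exists_sub_le_add {D : ℝ → ℝ} (hD : ∀ t, 0 ≤ t → 0 ≤ D t) {T δ : ℝ} (hT : 0 ≤ T)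
    (hδ : 0 < δ) : ∃ s, 0 ≤ s ∧ D s - D (s + T) ≤ δ := by
  by_contra! h
  have hi : ∀ i : ℕ, D (i * T) ≤ D 0 - i * δ := by
    intro i
    induction i with
    | zero => simp
    | succ i ih =>
      have := h (i * T) (by positivity)
      have e : ((i + 1 : ℕ) : ℝ) * T = i * T + T := by push_cast; ring
      rw [e]; push_cast
      linarith
  obtain ⟨m, hm⟩ := exists_nat_gt (D 0 / δ)
  rw [div_lt_iff₀ hδ] at hm
  linarith [hi m, hD (m * T) (by positivity)]

theorem intervalIntegrable_of_norm_le {F : Type*} [NormedAddCommGroup F] [MeasurableSpace F]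
    [BorelSpace F] [SecondCountableTopology F] {g : ℝ → F} {C : ℝ} (hg : Measurable g)
    (hC : ∀ t, ‖g t‖ ≤ C) {a b : ℝ} : IntervalIntegrable g volume a b :=
  (intervalIntegrable_const (c := C)).mono_fun hg.aestronglyMeasurable
    (Filter.Eventually.of_forall fun t => (hC t).trans (le_abs_self C))

section

open scoped RealInnerProductSpace

variable {E : Type*} [NormedAddCommGroup E] [InnerProductSpace ℝ E]

theorem inner_sub_le_of_norm_le_one {e v : E} (he : ‖e‖ = 1) (hv : ‖v‖ ≤ 1) :
    ⟪e, v - e⟫ ≤ -(1 / 2 * ‖v - e‖ ^ 2) := by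
  have h : ‖e + (v - e)‖ ^ 2 = ‖e‖ ^ 2 + 2 * ⟪e, v - e⟫ + ‖v - e‖ ^ 2 := norm_add_sq_real _ _
  rw [add_sub_cancel, he] at h
  nlinarith [norm_nonneg v]

variable [CompleteSpace E] [MeasurableSpace E] [BorelSpace E] [SecondCountableTopology E]

/-- Simple pursuit at unit speed in a bounded set comes within distance `ε` of an Evader of speed at
most `1`. -/
theorem exists_dist_le_of_pursuit {ε : ℝ} (hε : 0 < ε) {v x y : ℝ → E} (hv : Measurable v)
    (hv1 : ∀ t, ‖v t‖ ≤ 1) (hy : ∀ t, y t = y 0 + ∫ s in (0 : ℝ)..t, v s) (hyc : Continuous y)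
    (hx : ∀ t, HasDerivAt x (pursuitVelocity ε (y t - x t)) t) {R : ℝ}
    (hR : ∀ s t, 0 ≤ s → 0 ≤ t → dist (x s) (x t) ≤ R) :
    ∃ t, 0 ≤ t ∧ dist (x t) (y t) ≤ ε := by
  by_contra! hfar
  have hR0 : 0 ≤ R := dist_nonneg.trans (hR 0 0 le_rfl le_rfl)
  have hxc : Continuous x := continuous_iff_continuousAt.2 fun t => (hx t).continuousAt
  set z : ℝ → E := fun t => y t - x t with hz
  have hzc : Continuous z := hyc.sub hxc
  set e : ℝ → E := fun t => pursuitVelocity ε (z t) with he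
  have hec : Continuous e := (continuous_pursuitVelocity hε).comp hzc
  have he1 : ∀ t, ‖e t‖ ≤ 1 := fun t => norm_pursuitVelocity_le_one hε _
  have hzε : ∀ t, 0 ≤ t → ε < ‖z t‖ := fun t ht => by
    have := hfar t ht
    rwa [dist_comm, dist_eq_norm] at this
  have hze : ∀ t, 0 ≤ t → z t = ‖z t‖ • e t := fun t ht => by
    have h := hzε t ht
    simp only [he, pursuitVelocity]
    rw [max_eq_left h.le, smul_inv_smul₀ (hε.trans h).ne']
  have hen : ∀ t, 0 ≤ t → ‖e t‖ = 1 := fun t ht => by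
    have h := congrArg norm (hze t ht)
    rw [norm_smul, norm_norm] at h
    exact (mul_eq_left₀ (hε.trans (hzε t ht)).ne').1 h.symm
  set w : ℝ → E := fun t => v t - e t with hw
  have hwm : Measurable w := hv.sub hec.measurable
  have hw2 : ∀ t, ‖w t‖ ≤ 2 := fun t => (norm_sub_le _ _).trans (by linarith [hv1 t, he1 t])
  have hvi := fun a b => intervalIntegrable_of_norm_le (a := a) (b := b) hv hv1
  have hwi := fun a b => intervalIntegrable_of_norm_le (a := a) (b := b) hwm hw2
  have hzw : ∀ s t, z t - z s = ∫ r in s..t, w r := fun s t => by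
    have h1 : ∫ r in s..t, e r = x t - x s :=
      intervalIntegral.integral_eq_sub_of_hasDerivAt (fun r _ => hx r)
        (hec.intervalIntegrable _ _)
    have h2 : ∫ r in s..t, v r = y t - y s := by
      rw [hy t, hy s, add_sub_add_left_eq_sub,
        intervalIntegral.integral_interval_sub_left (hvi _ _) (hvi _ _)]
    simp only [hw, hz]
    rw [intervalIntegral.integral_sub (hvi _ _) (hec.intervalIntegrable _ _), h1, h2]
    abel
  have hzl : ∀ s t, ‖z t - z s‖ ≤ 2 * |t - s| := fun s t => by
    rw [hzw]
    exact intervalIntegral.norm_integral_le_of_norm_le_const fun r _ => hw2 r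
  have hw2m : Measurable fun r => ‖w r‖ ^ 2 := hwm.norm.pow_const 2
  have hw2i := fun a b => intervalIntegrable_of_norm_le (C := 4) (a := a) (b := b) hw2m fun t => by
    rw [norm_pow, norm_norm]
    nlinarith [hw2 t, norm_nonneg (w t)]
  -- `‖z‖` decreases at least at the rate `‖w‖ ^ 2 / 2`. Evader's velocity is only measurable, so
  -- this is expressed by increments: `‖z t‖ - ‖z s‖ ≤ ⟪e t, z t - z s⟫`, and replacing `e t` by
  -- `e r` inside the integral costs `O((t - s) ^ 2)`.
  set D : ℝ → ℝ := fun t => ‖z t‖ + ∫ r in (0 : ℝ)..t, 1 / 2 * ‖w r‖ ^ 2 with hD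
  have hDanti : AntitoneOn D (Ici 0) := by
    refine antitoneOn_of_sub_le_sq (C := 8 / ε) fun s t hs hst => ?_
    have ht := hs.trans hst
    have hsub : D t - D s = ‖z t‖ - ‖z s‖ + ∫ r in s..t, 1 / 2 * ‖w r‖ ^ 2 := by
      simp only [hD]
      rw [← intervalIntegral.integral_interval_sub_left ((hw2i 0 t).const_mul _)
        ((hw2i 0 s).const_mul _)]
      ring
    have h1 : ‖z t‖ - ‖z s‖ ≤ ⟪e t, z t - z s⟫ := by
      have h2 : ⟪e t, z t⟫ = ‖z t‖ := by
        conv_lhs => rw [hze t ht]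
        rw [inner_smul_right, real_inner_self_eq_norm_sq, hen t ht]
        ring
      have h3 : ⟪e t, z s⟫ ≤ ‖z s‖ := by
        have := real_inner_le_norm (e t) (z s)
        rwa [hen t ht, one_mul] at this
      rw [inner_sub_right, h2]
      linarith
    have h4 : ⟪e t, z t - z s⟫ = ∫ r in s..t, ⟪e t, w r⟫ := by
      rw [hzw]
      exact ((innerSL ℝ (e t)).intervalIntegral_comp_comm (hwi s t)).symm
    have h5 : ∫ r in s..t, ⟪e t, w r⟫ ≤
        ∫ r in s..t, (8 / ε * (t - s) - 1 / 2 * ‖w r‖ ^ 2) := by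
      refine intervalIntegral.integral_mono_on hst
        (intervalIntegrable_of_norm_le (C := 2) (hwm.const_inner) fun r => ?_)
        (intervalIntegrable_const.sub ((hw2i _ _).const_mul _)) fun r hr => ?_
      · refine (norm_inner_le_norm _ _).trans ?_
        nlinarith [he1 t, hw2 r, norm_nonneg (e t), norm_nonneg (w r)]
      · have hr0 : 0 ≤ r := hs.trans hr.1
        have h6 := inner_sub_le_of_norm_le_one (hen r hr0) (hv1 r)
        have h7 : ⟪e t - e r, w r⟫ ≤ 8 / ε * (t - s) := by
          refine (real_inner_le_norm _ _).trans ?_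
          have h8 : ‖e t - e r‖ ≤ 2 / ε * (2 * (t - s)) := by
            refine (norm_pursuitVelocity_sub_le hε _ _).trans ?_
            have h9 := hzl r t
            rw [abs_of_nonneg (by linarith [hr.2])] at h9
            have := hr.1
            gcongr
            linarith
          calc ‖e t - e r‖ * ‖w r‖ ≤ 2 / ε * (2 * (t - s)) * 2 :=
                mul_le_mul h8 (hw2 r) (norm_nonneg _) ((norm_nonneg _).trans h8)
            _ = 8 / ε * (t - s) := by ring
        rw [inner_sub_left] at h7
        have h6' : ⟪e r, w r⟫ ≤ -(1 / 2 * ‖w r‖ ^ 2) := h6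
        linarith
    rw [intervalIntegral.integral_sub intervalIntegrable_const ((hw2i _ _).const_mul _),
      intervalIntegral.integral_const, smul_eq_mul] at h5
    rw [hsub]
    nlinarith
  -- On an interval of length `T`, Pursuer covers at least `T / 2 > R` in the initial direction.
  set T : ℝ := 2 * R + 1 with hT
  have hT0 : 0 < T := by positivity
  obtain ⟨s, hs, hsT⟩ := exists_sub_le_add (D := fun t => ‖z t‖)
    (fun t _ => norm_nonneg _) hT0.le (δ := ε ^ 2 / (32 * T)) (by positivity)
  have hle : s ≤ s + T := by linarith
  have hint : ∫ r in s..(s + T), 1 / 2 * ‖w r‖ ^ 2 ≤ ε ^ 2 / (32 * T) := by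
    have h := hDanti (mem_Ici.2 hs) (mem_Ici.2 (hs.trans hle)) hle
    simp only [hD] at h
    rw [← intervalIntegral.integral_interval_sub_left ((hw2i 0 (s + T)).const_mul _)
        ((hw2i 0 s).const_mul _)]
    linarith
  have hzs : ∀ r ∈ Icc s (s + T), ‖z r - z s‖ ≤ ε / 4 := fun r hr => by
    have h1 : ‖z r - z s‖ ≤ ∫ q in s..r, ‖w q‖ := by
      rw [hzw]
      exact intervalIntegral.norm_integral_le_integral_norm hr.1
    have h2 : ∫ q in s..r, ‖w q‖ ≤ ∫ q in s..(s + T), ‖w q‖ :=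
      intervalIntegral.integral_mono_interval le_rfl hr.1 hr.2
        (Filter.Eventually.of_forall fun q => norm_nonneg _) (hwi _ _).norm
    -- `‖w‖ ≤ c / 2 + ‖w‖ ^ 2 / (2 * c)` with `c = ε / (4 * T)`, which balances the two terms
    have h3 : ∫ q in s..(s + T), ‖w q‖ ≤
        ∫ q in s..(s + T), (ε / (8 * T) + 4 * T / ε * (1 / 2 * ‖w q‖ ^ 2)) := by
      refine intervalIntegral.integral_mono_on hle (hwi _ _).norm
        (intervalIntegrable_const.add (((hw2i _ _).const_mul _).const_mul _)) fun q _ => ?_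
      have h4 : ε / (8 * T) + 4 * T / ε * (1 / 2 * ‖w q‖ ^ 2) - ‖w q‖ =
          (2 * T / ε) * (‖w q‖ - ε / (4 * T)) ^ 2 := by
        field_simp
        ring
      have h5 : 0 ≤ (2 * T / ε) * (‖w q‖ - ε / (4 * T)) ^ 2 := by positivity
      linarith
    rw [intervalIntegral.integral_add intervalIntegrable_const
      (((hw2i _ _).const_mul _).const_mul _), intervalIntegral.integral_const,
      intervalIntegral.integral_const_mul, smul_eq_mul] at h3
    have h6 : 4 * T / ε * ∫ q in s..(s + T), 1 / 2 * ‖w q‖ ^ 2 ≤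
        4 * T / ε * (ε ^ 2 / (32 * T)) := by gcongr
    have h7 : 4 * T / ε * (ε ^ 2 / (32 * T)) = ε / 8 := by field_simp; norm_num
    have h8 : (s + T - s) * (ε / (8 * T)) = ε / 8 := by field_simp; ring
    linarith
  have hlow : T * (1 / 2) ≤ ⟪e s, x (s + T) - x s⟫ := by
    have h1 : x (s + T) - x s = ∫ r in s..(s + T), e r :=
      (intervalIntegral.integral_eq_sub_of_hasDerivAt (fun r _ => hx r)
        (hec.intervalIntegrable _ _)).symm
    have h2 : ⟪e s, x (s + T) - x s⟫ = ∫ r in s..(s + T), ⟪e s, e r⟫ := by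
      rw [h1]
      exact ((innerSL ℝ (e s)).intervalIntegral_comp_comm (hec.intervalIntegrable _ _)).symm
    have h3 : ∫ _ in s..(s + T), (1 / 2 : ℝ) ≤ ∫ r in s..(s + T), ⟪e s, e r⟫ := by
      refine intervalIntegral.integral_mono_on hle intervalIntegrable_const
        ((continuous_const.inner hec).intervalIntegrable _ _) fun r hr => ?_
      have h4 : ‖e r - e s‖ ≤ 1 / 2 := by
        refine (norm_pursuitVelocity_sub_le hε _ _).trans ?_
        calc 2 / ε * ‖z r - z s‖ ≤ 2 / ε * (ε / 4) := by gcongr; exact hzs r hr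
          _ = 1 / 2 := by field_simp; norm_num
      have h5 : ⟪e s, e r⟫ = 1 + ⟪e s, e r - e s⟫ := by
        rw [inner_sub_right, real_inner_self_eq_norm_sq, hen s hs]
        ring
      have h6 := neg_le_of_abs_le (abs_real_inner_le_norm (e s) (e r - e s))
      rw [hen s hs] at h6
      linarith
    rw [intervalIntegral.integral_const, smul_eq_mul] at h3
    rw [h2]
    linarith
  have hup : ⟪e s, x (s + T) - x s⟫ ≤ R := by
    refine (real_inner_le_norm _ _).trans ?_
    rw [hen s hs, one_mul, ← dist_eq_norm]
    exact hR _ _ (by linarith) hs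
  linarith

end

/-! ### Trajectories of the game -/

/-- Evader's velocity can be extended to negative times, so that it is Borel and bounded on `ℝ`. -/
theorem exists_extension_of_mem_evaderStrategies {n : ℕ} {S : Set (EuclideanSpace ℝ (Fin n))}
    {y₀ : EuclideanSpace ℝ (Fin n)} {v : ℝ → EuclideanSpace ℝ (Fin n)}
    (hv : v ∈ evaderStrategies S y₀) :
    ∃ w y : ℝ → EuclideanSpace ℝ (Fin n), Measurable w ∧ (∀ t, ‖w t‖ ≤ 1) ∧
      (∀ t, 0 ≤ t → w t = v t) ∧ (∀ t, y t = y₀ + ∫ s in (0 : ℝ)..t, w s) ∧ Continuous y ∧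
      ∀ t, 0 ≤ t → evaderPosition y₀ v t = y t := by
  obtain ⟨hm, h1, -⟩ := hv
  set w : ℝ → EuclideanSpace ℝ (Fin n) := fun t => v (max t 0) with hw
  have hwm : Measurable w := by
    have : Measurable fun t : ℝ => (⟨max t 0, mem_Ici.2 (le_max_right t 0)⟩ : Ici (0 : ℝ)) :=
      (measurable_id.max measurable_const).subtype_mk
    exact hm.comp this
  have hw1 : ∀ t, ‖w t‖ ≤ 1 := fun t => h1 _ (le_max_right _ _)
  have hwv : ∀ t, 0 ≤ t → w t = v t := fun t ht => by simp only [hw, max_eq_left ht]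
  refine ⟨w, fun t => y₀ + ∫ s in (0 : ℝ)..t, w s, hwm, hw1, hwv, fun t => rfl,
    continuous_const.add (intervalIntegral.continuous_primitive
      (fun a b => intervalIntegrable_of_norm_le hwm hw1) 0), fun t ht => ?_⟩
  rw [evaderPosition]
  congr 1
  refine intervalIntegral.integral_congr fun s hs => ?_
  rw [uIcc_of_le ht] at hs
  exact (hwv s hs.1).symm

section

variable {n : ℕ} {ε : ℝ} {x₀ y₀ : EuclideanSpace ℝ (Fin n)} {v x y : ℝ → EuclideanSpace ℝ (Fin n)}

/-- Solutions of the differential equation are trajectories in the sense of the game. -/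
theorem isTrajectory_of_hasDerivAt (hε : 0 < ε) (hyc : Continuous y)
    (hy : ∀ t, 0 ≤ t → evaderPosition y₀ v t = y t) (hx0 : x 0 = x₀)
    (hx : ∀ t, HasDerivAt x (pursuitVelocity ε (y t - x t)) t) :
    IsTrajectory x₀ y₀ (fun p => pursuitVelocity ε (p.2.1 - p.1)) v x := by
  intro t ht
  have hxc : Continuous x := continuous_iff_continuousAt.2 fun t => (hx t).continuousAt
  have hc : Continuous fun s => pursuitVelocity ε (y s - x s) :=
    (continuous_pursuitVelocity hε).comp (hyc.sub hxc)
  have heq : ∀ s ∈ uIcc 0 t, pursuitVelocity ε (evaderPosition y₀ v s - x s) =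
      pursuitVelocity ε (y s - x s) := fun s hs => by
    rw [uIcc_of_le ht] at hs
    rw [hy s hs.1]
  refine ⟨(hc.intervalIntegrable 0 t).congr fun s hs => (heq s (uIoc_subset_uIcc hs)).symm, ?_⟩
  rw [intervalIntegral.integral_congr heq, intervalIntegral.integral_eq_sub_of_hasDerivAt
    (fun s _ => hx s) (hc.intervalIntegrable 0 t), hx0, add_sub_cancel]

/-- Uniqueness of the trajectory. A trajectory is only assumed to satisfy the integral equation; it is
therefore `1`-Lipschitz, its velocity is continuous, and it solves the differential equation. -/
theorem IsTrajectory.eqOn (hε : 0 < ε) (hyc : Continuous y)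
    (hy : ∀ t, 0 ≤ t → evaderPosition y₀ v t = y t) (hx0 : x 0 = x₀)
    (hx : ∀ t, HasDerivAt x (pursuitVelocity ε (y t - x t)) t)
    {x' : ℝ → EuclideanSpace ℝ (Fin n)}
    (hx' : IsTrajectory x₀ y₀ (fun p => pursuitVelocity ε (p.2.1 - p.1)) v x') :
    EqOn x' x (Ici 0) := by
  have hxc : Continuous x := continuous_iff_continuousAt.2 fun t => (hx t).continuousAt
  have hlip : LipschitzOnWith 1 x' (Ici 0) := by
    refine LipschitzOnWith.of_dist_le_mul fun s hs t ht => ?_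
    rw [dist_eq_norm, (hx' s hs).2, (hx' t ht).2, add_sub_add_left_eq_sub,
      intervalIntegral.integral_interval_sub_left (hx' s hs).1 (hx' t ht).1, Real.dist_eq]
    exact intervalIntegral.norm_integral_le_of_norm_le_const
      fun r _ => norm_pursuitVelocity_le_one hε _
  have hmax : Continuous fun s : ℝ => max s 0 := continuous_id.max continuous_const
  have hx'c : Continuous fun s => x' (max s 0) :=
    hlip.continuousOn.comp_continuous hmax fun s => le_max_right s 0
  set G : ℝ → EuclideanSpace ℝ (Fin n) := fun s => pursuitVelocity ε (y s - x' (max s 0)) with hG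
  have hGc : Continuous G := (continuous_pursuitVelocity hε).comp (hyc.sub hx'c)
  have hint : ∀ t ∈ Ici (0 : ℝ), x' t = x₀ + ∫ s in (0 : ℝ)..t, G s := fun t ht => by
    rw [(hx' t ht).2]
    congr 1
    refine intervalIntegral.integral_congr fun s hs => ?_
    rw [uIcc_of_le ht] at hs
    simp only [hG, hy s hs.1, max_eq_left hs.1]
  intro t ht
  refine ODE_solution_unique (v := fun t x => pursuitVelocity ε (y t - x)) (a := 0) (b := t)
    (fun t => lipschitzWith_pursuitVelocity_sub hε (y t))
    (hlip.continuousOn.mono fun s hs => hs.1) (fun s hs => ?_) hxc.continuousOn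
    (fun s _ => (hx s).hasDerivWithinAt) ?_ (right_mem_Icc.2 ht)
  · have h1 : HasDerivAt (fun r => x₀ + ∫ s in (0 : ℝ)..r, G s) (G s) s :=
      (hGc.integral_hasStrictDerivAt 0 s).hasDerivAt.const_add x₀
    have h2 : G s = pursuitVelocity ε (y s - x' s) := by simp only [hG, max_eq_left hs.1]
    rw [← h2]
    exact h1.hasDerivWithinAt.congr (fun r hr => hint r (hs.1.trans hr)) (hint s hs.1)
  · rw [hx0, hint 0 (mem_Ici.2 le_rfl), intervalIntegral.integral_same, add_zero]

theorem isWinningStrategy_pursuitVelocity {S : Set (EuclideanSpace ℝ (Fin n))}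
    (hc : Convex ℝ S) (hS : IsCompact S) (hε : 0 < ε) (hx₀ : x₀ ∈ S) :
    IsWinningStrategy S ε x₀ y₀ (fun p => pursuitVelocity ε (p.2.1 - p.1)) := by
  refine ⟨⟨((continuous_pursuitVelocity hε).comp
    ((continuous_fst.comp continuous_snd).sub continuous_fst)).measurable,
    fun p => norm_pursuitVelocity_le_one hε _⟩, fun v hv => ?_⟩
  obtain ⟨w, y, hwm, hw1, -, hyw, hyc, hyv⟩ := exists_extension_of_mem_evaderStrategies hv
  obtain ⟨x, hx0, hx⟩ := exists_pursuit hε hyc x₀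
  have hxS : ∀ t, 0 ≤ t → x t ∈ S := fun t ht =>
    pursuit_mem hε hc hS.isClosed hyc (fun s hs => hyv s hs ▸ hv.2.2 s hs) (hx0 ▸ hx₀) hx ht
  refine ⟨x, isTrajectory_of_hasDerivAt hε hyc hyv hx0 hx,
    fun x' hx' => hx'.eqOn hε hyc hyv hx0 hx, hxS, ?_⟩
  obtain ⟨t, ht, h⟩ := exists_dist_le_of_pursuit hε hwm hw1
    (fun t => by rw [hyw t, hyw 0, intervalIntegral.integral_same, add_zero]) hyc hx
    (fun s t hs ht => Metric.dist_le_diam_of_mem hS.isBounded (hxS s hs) (hxS t ht))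
  exact ⟨t, ht, by rwa [hyv t ht]⟩

/-! ### The error of the polygon method -/

/-- The error of one step of the polygon method with velocity `d`. -/
theorem dist_le_of_norm_deriv_sub_le {E : Type*} [NormedAddCommGroup E] [NormedSpace ℝ E]
    [CompleteSpace E] {f f' : ℝ → E} {a h C δ : ℝ} {d p : E} (hh : 0 ≤ h)
    (hf : f (a + h) = f a + ∫ s in a..(a + h), f' s) (hf' : IntervalIntegrable f' volume a (a + h))
    (hC : ∀ s ∈ Icc a (a + h), ‖f' s - d‖ ≤ C) (hp : dist (f a) p ≤ δ) :
    dist (f (a + h)) (p + h • d) ≤ δ + h * C := by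
  have e : f (a + h) - (p + h • d) = (f a - p) + ∫ s in a..(a + h), (f' s - d) := by
    rw [intervalIntegral.integral_sub hf' intervalIntegrable_const,
      intervalIntegral.integral_const, hf, add_sub_cancel_left]
    abel
  rw [dist_eq_norm] at hp ⊢
  rw [e]
  refine (norm_add_le _ _).trans (add_le_add hp ?_)
  have := intervalIntegral.norm_integral_le_of_norm_le_const (a := a) (b := a + h) (C := C)
    (f := fun s => f' s - d) fun s hs => hC s ?_
  · rwa [add_sub_cancel_left, abs_of_nonneg hh, mul_comm] at this
  · rw [uIoc_of_le (by linarith)] at hs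
    exact ⟨hs.1.le, hs.2⟩

/-- The error of the polygon method, by a discrete Grönwall argument; `l` is a Lipschitz constant of
the velocity. -/
theorem dist_pursuitPolygon_le (hε : 0 < ε) {l : ℝ} (hl : 2 / ε ≤ l)
    {w : ℝ → EuclideanSpace ℝ (Fin n)} (hw : Measurable w) (hw1 : ∀ t, ‖w t‖ ≤ 1)
    (hwv : ∀ t, 0 ≤ t → w t = v t) (hy : ∀ t, y t = y 0 + ∫ s in (0 : ℝ)..t, w s)
    (hyc : Continuous y) (hx : ∀ t, HasDerivAt x (pursuitVelocity ε (y t - x t)) t)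
    {val mod : ℕ → ℕ} (hv : RepresentsFunction val mod v) {K N J : ℕ} {h : ℚ} (h0 : 0 ≤ h)
    (hhK : (h : ℝ) ≤ 1 / 2 ^ K) (hmod : (h : ℝ) ≤ 1 / 2 ^ mod (Nat.pair N K))
    (hN : J * (h : ℝ) ≤ N) {X Y : ℕ → EuclideanSpace ℝ (Fin n)}
    (hP : IsPursuitPolygon ε val K h X Y) (hX0 : dist (x 0) (X 0) ≤ 1 / 2 ^ K)
    (hY0 : dist (y 0) (Y 0) ≤ 1 / 2 ^ K) :
    dist (x (J * h)) (X J) ≤ Real.exp (l * N) * ((5 + 2 * N) * (1 / 2 ^ K)) := by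
  have hxc : Continuous x := continuous_iff_continuousAt.2 fun t => (hx t).continuousAt
  have hh0 : (0 : ℝ) ≤ h := by exact_mod_cast h0
  have hl0 : 0 < l := lt_of_lt_of_le (by positivity) hl
  set η : ℝ := 1 / 2 ^ K with hη
  have hη0 : 0 < η := by positivity
  have hwi : ∀ a b, IntervalIntegrable w volume a b := fun a b =>
    intervalIntegrable_of_norm_le hw hw1
  have hec : Continuous fun s => pursuitVelocity ε (y s - x s) :=
    (continuous_pursuitVelocity hε).comp (hyc.sub hxc)
  have hyi : ∀ a b, y b = y a + ∫ s in a..b, w s := fun a b => by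
    rw [hy a, hy b, ← intervalIntegral.integral_add_adjacent_intervals (hwi 0 a) (hwi a b),
      add_assoc]
  have hxi : ∀ a b, x b = x a + ∫ s in a..b, pursuitVelocity ε (y s - x s) := fun a b => by
    rw [intervalIntegral.integral_eq_sub_of_hasDerivAt (fun s _ => hx s)
      (hec.intervalIntegrable a b), add_sub_cancel]
  have hylip : ∀ a b, ‖y b - y a‖ ≤ |b - a| := fun a b => by
    rw [hyi a b, add_sub_cancel_left, ← one_mul |b - a|]
    exact intervalIntegral.norm_integral_le_of_norm_le_const fun s _ => hw1 s
  have hxlip : ∀ a b, ‖x b - x a‖ ≤ |b - a| := fun a b => by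
    rw [hxi a b, add_sub_cancel_left, ← one_mul |b - a|]
    exact intervalIntegral.norm_integral_le_of_norm_le_const
      fun s _ => norm_pursuitVelocity_le_one hε _
  have hsucc : ∀ j : ℕ, ((j + 1 : ℕ) : ℝ) * h = j * h + h := fun j => by push_cast; ring
  have hjN : ∀ j, j ≤ J → (j : ℝ) * h ≤ N := fun j hj =>
    (mul_le_mul_of_nonneg_right (by exact_mod_cast hj) hh0).trans hN
  have hYerr : ∀ j, j ≤ J → dist (y (j * h)) (Y j) ≤ η + j * h * (2 * η) := by
    intro j
    induction j with
    | zero => intro _; simpa using hY0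
    | succ j ih =>
      intro hj
      obtain ⟨c, hc, hYs⟩ := hP.evader j
      have hcr : (ratOfCode c : ℝ) = j * h := by rw [hc]; push_cast; rfl
      have hj0 : (0 : ℝ) ≤ j * h := by positivity
      have hend := hjN (j + 1) hj
      rw [hsucc] at hend
      rw [hsucc, hYs]
      refine (dist_le_of_norm_deriv_sub_le hh0 (hyi _ _) (hwi _ _) (C := 2 * η)
        (fun s hs => ?_) (ih (by omega))).trans_eq (by ring)
      have h1 := hv.val_spec c K (by rw [hc]; positivity)
      rw [hcr] at h1
      have h2 := hv.mod_spec N K s ⟨hj0.trans hs.1, hs.2.trans hend⟩ (j * h)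
        ⟨hj0, by linarith⟩ (by
          rw [abs_of_nonneg (by linarith [hs.1])]
          linarith [hs.2])
      rw [hwv s (hj0.trans hs.1), ← dist_eq_norm]
      refine (dist_triangle _ _ _).trans (add_le_add h2 h1) |>.trans_eq (by ring)
  -- `B` is the fixed point that turns the recursion `δ ↦ δ + h * (l * (δ + B))` for the error into
  -- the multiplication of `δ + B` by `1 + h * l`.
  set B : ℝ := (4 + 2 * N) * η with hB
  have hXerr : ∀ j, j ≤ J → dist (x (j * h)) (X j) + B ≤ (1 + h * l) ^ j * (η + B) := by
    intro j
    induction j with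
    | zero =>
      intro _
      rw [pow_zero, one_mul, Nat.cast_zero, zero_mul]
      linarith
    | succ j ih =>
      intro hj
      obtain ⟨r, hr, hr', hXs⟩ := hP.pursuer j
      have hih := ih (by omega)
      have hY := hYerr j (by omega)
      have hjN' := hjN j (by omega)
      set δ := dist (x (j * h)) (X j) with hδ
      have hstep : dist (x (j * h + h)) (X j + (h : ℝ) • r⁻¹ • (Y j - X j)) ≤
          δ + h * (l * (δ + B)) := by
        refine dist_le_of_norm_deriv_sub_le hh0 (hxi _ _) (hec.intervalIntegrable _ _)
          (fun s hs => ?_) le_rfl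
        rw [norm_sub_rev]
        refine (norm_inv_smul_sub_pursuitVelocity_le hε hr _ _).trans ?_
        set D := ‖Y j - X j - (y s - x s)‖ with hD
        have hs1 : |s - j * h| ≤ η := by
          rw [abs_of_nonneg (by linarith [hs.1])]
          linarith [hs.2]
        have hDle : D ≤ δ + (3 + 2 * N) * η := by
          have e : Y j - X j - (y s - x s) = (x s - x (j * h)) + (x (j * h) - X j) -
              (y s - y (j * h)) - (y (j * h) - Y j) := by abel
          have h1 := norm_sub_le ((x s - x (j * h)) + (x (j * h) - X j) - (y s - y (j * h)))
            (y (j * h) - Y j)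
          have h2 := norm_sub_le ((x s - x (j * h)) + (x (j * h) - X j)) (y s - y (j * h))
          have h3 := norm_add_le (x s - x (j * h)) (x (j * h) - X j)
          have h4 := hxlip (j * h) s
          have h5 := hylip (j * h) s
          rw [← e] at h1
          rw [dist_eq_norm] at hY hδ
          have h6 : (j * h : ℝ) * (2 * η) ≤ N * (2 * η) := by gcongr
          linarith
        have hrle : |r - max ‖y s - x s‖ ε| ≤ 2 * η + D := by
          have h1 := abs_sub_le r (max ‖Y j - X j‖ ε) (max ‖y s - x s‖ ε)
          have h2 := (abs_max_sub_max_le_abs ‖Y j - X j‖ ‖y s - x s‖ ε).trans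
            (abs_norm_sub_norm_le (Y j - X j) (y s - x s))
          linarith
        calc (D + |r - max ‖y s - x s‖ ε|) / ε ≤ (2 * (δ + B)) / ε := by
              gcongr
              linarith
          _ = 2 / ε * (δ + B) := by ring
          _ ≤ l * (δ + B) := by gcongr
      rw [hsucc, hXs]
      calc dist (x (j * h + h)) (X j + (h : ℝ) • r⁻¹ • (Y j - X j)) + B
          ≤ (1 + h * l) * (δ + B) := by linarith
        _ ≤ (1 + h * l) * ((1 + h * l) ^ j * (η + B)) := by gcongr
        _ = (1 + h * l) ^ (j + 1) * (η + B) := by ring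
  have hpow : (1 + h * l) ^ J ≤ Real.exp (l * N) := by
    calc (1 + h * l) ^ J ≤ Real.exp (h * l) ^ J := by
          gcongr
          rw [add_comm]
          exact Real.add_one_le_exp _
      _ = Real.exp (l * (J * h)) := by rw [← Real.exp_nat_mul]; congr 1; ring
      _ ≤ Real.exp (l * N) := by gcongr
  calc dist (x (J * h)) (X J) ≤ dist (x (J * h)) (X J) + B := le_add_of_nonneg_right (by positivity)
    _ ≤ (1 + h * l) ^ J * (η + B) := hXerr J le_rfl
    _ ≤ Real.exp (l * N) * (η + B) := by gcongr
    _ = Real.exp (l * N) * ((5 + 2 * N) * η) := by rw [hB]; ring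

/-- The precision `k + 4 + N + 2 * l * N` outweighs the growth of the error up to time `N`. -/
theorem exp_mul_le_one_div_two_pow (l N k : ℕ) :
    Real.exp (l * N) * ((5 + 2 * N) * (1 / 2 ^ (k + 4 + N + 2 * l * N))) ≤ 1 / 2 ^ (k + 1) := by
  have h1 : Real.exp (l * N) ≤ 2 ^ (2 * l * N) := by
    have : Real.exp 1 ≤ 2 ^ 2 := by
      have := Real.exp_one_lt_d9
      norm_num
      linarith
    calc Real.exp (l * N) = Real.exp 1 ^ (l * N) := by
          rw [← Real.exp_nat_mul]; push_cast; rw [mul_one]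
      _ ≤ (2 ^ 2) ^ (l * N) := by gcongr
      _ = 2 ^ (2 * l * N) := by rw [← pow_mul]; ring_nf
  have h2 : (5 + 2 * N : ℝ) ≤ 8 * 2 ^ N := by
    have : (N : ℝ) + 1 ≤ 2 ^ N := by exact_mod_cast (Nat.lt_two_pow_self (n := N))
    linarith [N.cast_nonneg (α := ℝ)]
  calc Real.exp (l * N) * ((5 + 2 * N) * (1 / 2 ^ (k + 4 + N + 2 * l * N)))
      ≤ 2 ^ (2 * l * N) * (8 * 2 ^ N * (1 / 2 ^ (k + 4 + N + 2 * l * N))) := by gcongr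
    _ = 1 / 2 ^ (k + 1) := by
        have e : (2 : ℝ) ^ (k + 4 + N + 2 * l * N) =
            2 ^ (k + 1) * (8 * 2 ^ N * 2 ^ (2 * l * N)) := by
          rw [pow_add, pow_add, pow_add, pow_add]
          ring
        rw [e]
        field_simp

end

end Pursuit

theorem theorem4 (n : ℕ) (S : Set (EuclideanSpace ℝ (Fin n)))
    (hS : Pursuit.IsComputableConvex S) (hcompact : IsCompact S)
    (ε : ℚ) (hε : 0 < ε) (x₀ y₀ : EuclideanSpace ℝ (Fin n))
    (hx₀S : x₀ ∈ S) (hy₀S : y₀ ∈ S)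
    (hx₀ : Pursuit.ComputablePoint x₀) (hy₀ : Pursuit.ComputablePoint y₀)
    (hdist : (ε : ℝ) < dist x₀ y₀) :
    ∃ u : EuclideanSpace ℝ (Fin n) × EuclideanSpace ℝ (Fin n) × EuclideanSpace ℝ (Fin n) →
        EuclideanSpace ℝ (Fin n),
      Pursuit.IsWinningStrategy S (ε : ℝ) x₀ y₀ u ∧
      ∀ v ∈ Pursuit.evaderStrategies S y₀, ContinuousOn v (Set.Ici 0) →
        ∀ x : ℝ → EuclideanSpace ℝ (Fin n), Pursuit.IsTrajectory x₀ y₀ u v x →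
          Pursuit.ComputableRelativeTo v x := by
  have hε' : (0 : ℝ) < ε := by exact_mod_cast hε
  refine ⟨fun p => Pursuit.pursuitVelocity ε (p.2.1 - p.1),
    Pursuit.isWinningStrategy_pursuitVelocity hS.convex hcompact hε' hx₀S, fun v hv _ x' hx' => ?_⟩
  obtain ⟨w, y, hwm, hw1, hwv, hyw, hyc, hyv⟩ :=
    Pursuit.exists_extension_of_mem_evaderStrategies hv
  obtain ⟨x, hx0, hx⟩ := Pursuit.exists_pursuit hε' hyc x₀
  have hxx' := hx'.eqOn hε' hyc hyv hx0 hx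
  have hy0 : y 0 = y₀ := by rw [hyw, intervalIntegral.integral_same, add_zero]
  obtain ⟨px, hpx, hpx'⟩ := hx₀
  obtain ⟨py, hpy, hpy'⟩ := hy₀
  obtain ⟨l, hl⟩ := exists_nat_ge (2 / (ε : ℝ))
  obtain ⟨f, ⟨M, hM⟩, hf⟩ :=
    Pursuit.exists_oracleComputable_pursuitPolygon n ε (2 * l) hpx hpy
  refine ⟨M, fun val mod hrep t ht φ hφ k => ⟨f ![φ, val, mod] k, ?_, ?_⟩⟩
  · rw [hM]
    exact Part.mem_some _
  rw [hxx' (Set.mem_Ici.2 ht)]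
  -- The error is at most `2⁻ᵏ⁻²` from the time and `2⁻ᵏ⁻¹` from the polygon.
  have hk := hf φ val mod k
  dsimp only at hk
  have hq := hφ (k + 2)
  generalize Pursuit.ratOfCode (φ (k + 2)) = q at hk hq
  set τ : ℚ := max q 0 with hτ
  set N : ℕ := ⌊τ⌋₊ + 1 with hN
  set K : ℕ := k + 4 + N + 2 * l * N with hK
  set m : ℕ := mod (Nat.pair N K) with hm
  set J : ℕ := N * 2 ^ (m + K) with hJ
  obtain ⟨X, Y, hP, hX0, hY0, hout⟩ := hk
  have hτ0 : 0 ≤ τ := le_max_right _ _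
  have hτN : (τ : ℝ) ≤ N := by
    have : τ ≤ N := by rw [hN]; push_cast; exact (Nat.lt_floor_add_one τ).le
    exact_mod_cast this
  have hN0 : (0 : ℝ) < N := by rw [hN]; positivity
  have hJ0 : (0 : ℝ) < J := by rw [hJ]; push_cast; positivity
  have hJh : (J : ℝ) * ((τ * (J : ℚ)⁻¹ : ℚ) : ℝ) = τ := by push_cast; field_simp
  have hh : ((τ * (J : ℚ)⁻¹ : ℚ) : ℝ) ≤ 1 / 2 ^ (m + K) := by
    push_cast
    rw [← div_eq_mul_inv, div_le_div_iff₀ hJ0 (by positivity), one_mul, hJ]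
    push_cast
    gcongr
  have hpow : ∀ a b : ℕ, a ≤ b → (1 / 2 ^ b : ℝ) ≤ 1 / 2 ^ a := fun a b hab => by
    gcongr
    norm_num
  have herr := Pursuit.dist_pursuitPolygon_le hε' hl hwm hw1 hwv
    (fun t => by rw [hyw t, hy0]) hyc hx hrep (J := J) (N := N) (K := K)
    (mul_nonneg hτ0 (inv_nonneg.2 (Nat.cast_nonneg J)))
    (hh.trans (hpow _ _ (Nat.le_add_left _ _))) (hh.trans (hpow _ _ (Nat.le_add_right _ _)))
    (hJh.trans_le hτN) hP (by rw [hx0, hX0]; exact hpx' K) (by rw [hy0, hY0]; exact hpy' K)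
  rw [hJh] at herr
  have htτ : |t - τ| ≤ 1 / 2 ^ (k + 2) := by
    rw [hτ]
    push_cast
    have := abs_max_sub_max_le_abs t (q : ℝ) 0
    rw [max_eq_left ht] at this
    exact this.trans hq
  have hxt : dist (x t) (x τ) ≤ |t - τ| := by
    rw [dist_eq_norm]
    have := convex_univ.norm_image_sub_le_of_norm_hasDerivWithin_le (f := x) (x := (τ : ℝ)) (y := t)
      (fun s _ => (hx s).hasDerivWithinAt)
      (fun s _ => Pursuit.norm_pursuitVelocity_le_one hε' _) (Set.mem_univ _) (Set.mem_univ _)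
    rwa [one_mul] at this
  have hexp := Pursuit.exp_mul_le_one_div_two_pow l N k
  rw [hout]
  have htri := dist_triangle (x t) (x τ) (X J)
  have e1 : (1 / 2 ^ (k + 2) : ℝ) = 1 / 4 * (1 / 2 ^ k) := by rw [pow_add]; field_simp; norm_num
  have e2 : (1 / 2 ^ (k + 1) : ℝ) = 1 / 2 * (1 / 2 ^ k) := by rw [pow_add]; field_simp
  have e3 : (0 : ℝ) < 1 / 2 ^ k := by positivity
  linarith
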